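/- Notation. Let $\sigma(x)=\max\{0,x\}$, applied entrywise, and write $[I]=\{1,\dots,I\}$. A transformer layer on $\mathbb{R}^D$ with $M$ heads and FFN width $D'$ ($M,D'\ge 1$) has parameters $\theta=((Q_m,K_m,V_m)_{m\in[M]},W_1,W_2)$ with $Q_m,K_m,V_m\in\mathbb{R}^{D\times D}$, $W_1\in\mathbb{R}^{D'\times D}$, $W_2\in\mathbb{R}^{D\times D'}$. It maps $H=[h_1,\dots,h_n]\in\mathbb{R}^{D\times n}$ (any $n$) first to $G=[g_1,\dots,g_n]$, $g_j=h_j+\sum_{m\in[M]}\sum_{j'\in[n]}\sigma(\langle Q_mh_j,K_mh_{j'}\rangle)V_mh_{j'}$, and then to $G+W_2\sigma(W_1G)$. An $l$-layer transformer $\mathrm{TF}_\Theta$, $\Theta=(\theta_1,\dots,\theta_l)$, is the composition $\mathrm{TF}_{\theta_l}\circ\cdots\circ\mathrm{TF}_{\theta_1}$; $\|\Theta\|_0$ is the number of nonzero entries of all its parameter matrices and $\|\Theta\|_{\max}$ the largest absolute value of such an entry. Given $[h_1,\dots,h_n]$ it sequentially generates $h_{n+1},h_{n+2},\dots$, where $h_{n+v+1}$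 is the last column of $\mathrm{TF}_\Theta([h_1,\dots,h_{n+v}])$ for $v\ge 0$. For $d\ge1$ put $p(w,j,S)=(0_{3d+4}^\top,1,S,Sw,Sj)^\top\in\mathbb{R}^{3d+8}$. For $\mathcal U\subset\mathbb{R}^d$ let $\mathcal P_{\mathcal U}(T,L,S)$ be the set of all $[h_1,\dots,h_T]\in\mathbb{R}^{(4d+8)\times T}$ with $h_j=(u_j^\top,p(w_j,j,S)^\top)^\top$, $u_j\in\mathcal U$, $w_j\in[2L]$; $w_j$ is called the layer tag of $h_j$ and $u_j=(h_j)_{1:d}$ its embedding. For $z\in\mathbb{R}^d$ let $h^{\mathrm D}(z,j,S)=(z^\top,p(0,j,S)^\top)^\top$. Theorem. There are constants $C_1,C_2,C_3$ such that for every $d\in\mathbb{N}^+$ there is a $7$-layer transformer $\mathrm{TF}_{\Theta^*}$ on $\mathbb{R}^{4d+8}$ (so $\Theta^*$ depends only on $d$) with the following properties. (P1) Each layer of $\mathrm{TF}_{\Theta^*}$ has at most $8$ heads and FFN width at most $C_1d$. (P2) $\|\Theta^*\|_0\le C_2d$ and $\|\Theta^*\|_{\max}\le C_3$. (P3) Let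 $B\ge1$, $L,T\in\mathbb{N}^+$, let $\mathcal U$ be a subset of the closed Euclidean ball of radius $B$ around $0$ in $\mathbb{R}^d$, and let $S\ge\max\{dB^{4L}T^{2L},2L\}$. For every prompt $H^{\mathrm P}=[h_1,\dots,h_T]\in\mathcal P_{\mathcal U}(T,L,S)$ with layer tags $w_1,\dots,w_T$, every $N\in\mathbb{N}^+$ and all $z_1,\dots,z_N\in[0,1]^d$, the tokens $h_{T+N+1},h_{T+N+2},\dots$ sequentially generated by $\mathrm{TF}_{\Theta^*}$ from $[H^{\mathrm P},h^{\mathrm D}(z_1,T+1,S),\dots,h^{\mathrm D}(z_N,T+N,S)]$ satisfy $$h_{T+N\ell+i}=\begin{pmatrix}W^{\mathrm P}_\ell\,\sigma(W^{\mathrm P}_{\ell-1}\,\sigma(\cdots\sigma(W^{\mathrm P}_{1,i}z_i)\cdots))\\ p(-\ell,T+N\ell+i,S)\end{pmatrix}\qquad\text{for all }i\in[N],\ \ell\in[L]$$ (for $\ell=1$ the upper part is $W^{\mathrm P}_{1,i}z_i$), where, with $\mathbb I$ the indicator, $$W^{\mathrm P}_{1,i}=\sum_{j\in[T-1]}\mathbb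 I\{w_j=1,\,w_{j+1}=2\}\,u_ju_{j+1}^\top+\mathbb I\{i=1,\,w_T=1\}\,u_T\sum_{j\in[T]}\mathbb I\{w_j=1\}\,u_j^\top,$$ $$W^{\mathrm P}_\ell=\sum_{j\in[T-1]}\mathbb I\{w_j=2\ell-1,\,w_{j+1}=2\ell\}\,u_ju_{j+1}^\top\qquad\text{for }2\le\ell\le L.$$ -/

import Mathlib

open scoped Matrix NNReal

noncomputable section

namespace PromptTF

/-- A token matrix with `n` columns in `ℝ^D`, given by its columns: `H j` is the column number
`j + 1`. -/
abbrev TokenSeq (D n : ℕ) : Type := Fin n → Fin D → ℝ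

/-- The ReLU activation. -/
def relu (x : ℝ) : ℝ := max 0 x

/-- The ReLU activation applied entrywise. -/
def reluVec {ι : Type} (x : ι → ℝ) : ι → ℝ := fun k => relu (x k)

/-! ### Transformers -/

/-- The parameters of one transformer layer with token dimension `D`: an attention layer with
`heads` heads and a feed-forward network of width `width`. -/
structure Layer (D : ℕ) where
  heads : ℕ
  heads_pos : 0 < heads
  width : ℕ
  width_pos : 0 < width
  Q : Fin heads → Matrix (Fin D) (Fin D) ℝ
  K : Fin heads → Matrix (Fin D) (Fin D) ℝ
  V : Fin heads → Matrix (Fin D) (Fin D) ℝ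
  W₁ : Matrix (Fin width) (Fin D) ℝ
  W₂ : Matrix (Fin D) (Fin width) ℝ

/-- Self-attention with ReLU activation. -/
def Layer.attn {D n : ℕ} (θ : Layer D) (H : TokenSeq D n) : TokenSeq D n := fun j =>
  H j + ∑ m, ∑ j', relu ((θ.Q m *ᵥ H j) ⬝ᵥ (θ.K m *ᵥ H j')) • (θ.V m *ᵥ H j')

/-- Feed-forward transformation, acting on each token separately. -/
def Layer.ffn {D n : ℕ} (θ : Layer D) (H : TokenSeq D n) : TokenSeq D n := fun j =>
  H j + θ.W₂ *ᵥ reluVec (θ.W₁ *ᵥ H j)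

/-- One transformer layer. -/
def Layer.apply {D n : ℕ} (θ : Layer D) (H : TokenSeq D n) : TokenSeq D n := θ.ffn (θ.attn H)

/-- Parameters of an `l`-layer transformer; `Θ 0` is the first layer. -/
abbrev Transformer (D l : ℕ) : Type := Fin l → Layer D

/-- The map of the transformer: the layers are applied one after the other. -/
def Transformer.apply {D l n : ℕ} (Θ : Transformer D l) (H : TokenSeq D n) : TokenSeq D n :=
  (List.ofFn Θ).foldl (fun X θ => θ.apply X) H

/-- The number of nonzero entries of a matrix. -/
def matZeroNorm {a b : ℕ} (A : Matrix (Fin a) (Fin b) ℝ) : ℕ :=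
  {p : Fin a × Fin b | A p.1 p.2 ≠ 0}.ncard

/-- The largest absolute value of an entry of a matrix. -/
def matMaxNorm {a b : ℕ} (A : Matrix (Fin a) (Fin b) ℝ) : ℝ≥0 :=
  Finset.univ.sup fun p : Fin a × Fin b => ‖A p.1 p.2‖₊

/-- The number of nonzero parameters of a transformer. -/
def Transformer.zeroNorm {D l : ℕ} (Θ : Transformer D l) : ℕ :=
  ∑ k, (matZeroNorm (Θ k).W₁ + matZeroNorm (Θ k).W₂ +
    ∑ m, (matZeroNorm ((Θ k).Q m) + matZeroNorm ((Θ k).K m) + matZeroNorm ((Θ k).V m)))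

/-- The largest absolute value of a parameter of a transformer. -/
def Transformer.maxNorm {D l : ℕ} (Θ : Transformer D l) : ℝ≥0 :=
  Finset.univ.sup fun k => matMaxNorm (Θ k).W₁ ⊔ matMaxNorm (Θ k).W₂ ⊔
    Finset.univ.sup fun m =>
      matMaxNorm ((Θ k).Q m) ⊔ matMaxNorm ((Θ k).K m) ⊔ matMaxNorm ((Θ k).V m)

/-! ### Sequential generation -/

/-- The last column of a nonempty token sequence. -/
def lastToken {D n : ℕ} (hn : 0 < n) (H : TokenSeq D n) : Fin D → ℝ :=
  H ⟨n - 1, Nat.sub_lt hn Nat.one_pos⟩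

/-- The sequence `[h₁, …, h_{n+v}]` after `v` generation steps started at `H = [h₁, …, hₙ]`:
each step appends the last column of the transformer's output. -/
def generate {D l n : ℕ} (Θ : Transformer D l) (hn : 0 < n) (H : TokenSeq D n) :
    (v : ℕ) → TokenSeq D (n + v)
  | 0 => H
  | v + 1 => Fin.snoc (α := fun _ => Fin D → ℝ) (generate Θ hn H v)
      (lastToken (Nat.add_pos_left hn v) (Θ.apply (generate Θ hn H v)))

/-- The token `h_{n+v+1}` generated from the initial sequence `H = [h₁, …, hₙ]`. -/
def generatedToken {D l n : ℕ} (Θ : Transformer D l) (hn : 0 < n) (H : TokenSeq D n) (v : ℕ) :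
    Fin D → ℝ :=
  lastToken (Nat.add_pos_left hn v) (Θ.apply (generate Θ hn H v))

/-! ### Tokens and prompts -/

/-- The positional encoding `p(w, j, S) = (0_{3d+4}, 1, S, S w, S j)`. -/
def posEnc (d : ℕ) (w : ℤ) (j : ℕ) (S : ℝ) : Fin (3 * d + 8) → ℝ := fun k =>
  if (k : ℕ) = 3 * d + 4 then 1
  else if (k : ℕ) = 3 * d + 5 then S
  else if (k : ℕ) = 3 * d + 6 then S * w
  else if (k : ℕ) = 3 * d + 7 then S * j
  else 0

/-- The token `(u, p)` in `ℝ^{4d+8}`. -/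
def token {d : ℕ} (u : Fin d → ℝ) (p : Fin (3 * d + 8) → ℝ) : Fin (4 * d + 8) → ℝ := fun k =>
  if h : (k : ℕ) < d then u ⟨k, h⟩ else p ⟨(k : ℕ) - d, by omega⟩

/-- The word embedding of a token: its first `d` coordinates. -/
def emb {d : ℕ} (h : Fin (4 * d + 8) → ℝ) : Fin d → ℝ := fun k => h ⟨k, by omega⟩

/-- The positional part of a token: its last `3d+8` coordinates. -/
def pos {d : ℕ} (h : Fin (4 * d + 8) → ℝ) : Fin (3 * d + 8) → ℝ := fun k => h ⟨d + k, by omega⟩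

/-- The class of prompts with exactly `T` tokens, word embeddings in `U`, layer tags in
`{1, …, 2L}` and scale `S`. -/
def promptClass {d : ℕ} (U : Set (EuclideanSpace ℝ (Fin d))) (T L : ℕ) (S : ℝ) :
    Set (TokenSeq (4 * d + 8) T) :=
  {H | ∃ (u : Fin T → EuclideanSpace ℝ (Fin d)) (w : Fin T → ℤ),
    (∀ j, u j ∈ U) ∧ (∀ j, 1 ≤ w j ∧ w j ≤ 2 * (L : ℤ)) ∧
    ∀ j, H j = token (u j) (posEnc d (w j) ((j : ℕ) + 1) S)}

/-- `w` is the sequence of layer tags carried by the tokens of the prompt `H` of scale `S`. -/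
def HasTags {d T : ℕ} (S : ℝ) (H : TokenSeq (4 * d + 8) T) (w : Fin T → ℤ) : Prop :=
  ∀ j, pos (H j) = posEnc d (w j) ((j : ℕ) + 1) S

theorem pos_token {d : ℕ} (u : Fin d → ℝ) (p : Fin (3 * d + 8) → ℝ) : pos (token u p) = p := by
  funext k
  simp [pos, token]

theorem exists_hasTags {d T L : ℕ} {U : Set (EuclideanSpace ℝ (Fin d))} {S : ℝ}
    {H : TokenSeq (4 * d + 8) T} (hH : H ∈ promptClass U T L S) : ∃ w, HasTags S H w := by
  obtain ⟨u, w, -, -, h⟩ := hH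
  exact ⟨w, fun j => by rw [h j, pos_token]⟩

theorem HasTags.unique {d T : ℕ} {S : ℝ} (hS : S ≠ 0) {H : TokenSeq (4 * d + 8) T}
    {w w' : Fin T → ℤ} (h : HasTags S H w) (h' : HasTags S H w') : w = w' := by
  funext j
  have e := congrFun ((h j).symm.trans (h' j)) ⟨3 * d + 6, by omega⟩
  simpa [posEnc, hS] using e

/-- The data token number `j` with datum `z`. -/
def dataToken {d : ℕ} (z : Fin d → ℝ) (j : ℕ) (S : ℝ) : Fin (4 * d + 8) → ℝ :=
  token z (posEnc d 0 j S)

/-- The data tokens `h_{T+1}, …, h_{T+N}`. -/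
def dataTokens {d N : ℕ} (z : Fin N → Fin d → ℝ) (T : ℕ) (S : ℝ) : TokenSeq (4 * d + 8) N :=
  fun i => dataToken (z i) (T + ((i : ℕ) + 1)) S

/-! ### The virtual network -/

/-- The sum, over consecutive prompt tokens with tags `2ℓ-1` and `2ℓ`, of the outer products of
their word embeddings. -/
def promptWeight {d T : ℕ} (H : TokenSeq (4 * d + 8) T) (w : Fin T → ℤ) (ℓ : ℕ) :
    Matrix (Fin d) (Fin d) ℝ :=
  ∑ j : Fin (T - 1),
    if w ⟨j, by omega⟩ = 2 * (ℓ : ℤ) - 1 ∧ w ⟨j + 1, by omega⟩ = 2 * (ℓ : ℤ) then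
      Matrix.vecMulVec (emb (H ⟨j, by omega⟩)) (emb (H ⟨j + 1, by omega⟩))
    else 0

/-- The first weight matrix seen by the datum number `i + 1`: for the first datum there is an
additional term when the last prompt token has tag `1`. -/
def firstWeight {d T : ℕ} (hT : 0 < T) (H : TokenSeq (4 * d + 8) T) (w : Fin T → ℤ) (i : ℕ) :
    Matrix (Fin d) (Fin d) ℝ :=
  promptWeight H w 1 +
    if i = 0 ∧ w ⟨T - 1, by omega⟩ = 1 then
      Matrix.vecMulVec (emb (H ⟨T - 1, by omega⟩)) (∑ j, if w j = 1 then emb (H j) else 0)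
    else 0

/-- `W_ℓ σ(W_{ℓ-1} σ(⋯ σ(A z)⋯))`, the output of the first `ℓ` layers of the network whose first
weight matrix is `A` and whose further weight matrices are `W 2, W 3, …`. -/
def network {d : ℕ} (A : Matrix (Fin d) (Fin d) ℝ) (W : ℕ → Matrix (Fin d) (Fin d) ℝ)
    (z : Fin d → ℝ) : ℕ → Fin d → ℝ
  | 0 => z
  | 1 => A *ᵥ z
  | ℓ + 2 => W (ℓ + 2) *ᵥ reluVec (network A W z (ℓ + 1))

end PromptTF

end

open PromptTF

noncomputable section

namespace PromptTF

section

/-! ### Block coordinates -/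

/-! Positions, tags and the number of data tokens enter only as integer multiples of `S`, and all
real quantities to be transmitted are at most `S` in absolute value. Under these conditions four
ReLUs form an exact switch (`gate_mul_intCast`): the weight `a` passes when an integer condition
vanishes and is cancelled otherwise. Four heads thus make a selector, which adds values of exactly
those keys that satisfy a condition linear in the tags and positions of query and key
(`Selector.sum_heads`); two selectors fill the eight heads.

Four layers do the work. The first counts the tags `0`, which gives `S N`, and attaches to each
token the embedding of its successor, masked unless the tag rises by one. The second lets the last
token fetch the token whose number is `N` less than that of the token to be generated, and applies
ReLU to its embedding to get `x`. The third adds `(x ⬝ᵥ u_{j+1}) • u_j` over the pairs with tags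
`2ℓ-1`, `2ℓ`, that is, it applies the weight matrix. The fourth adds the boundary term, which
survives only when the token `N` places back is the last prompt token with tag `1`, and writes the
new token in clean form. Three identity layers complete the seven. This is
`promptTransformer_apply_last`.

The outputs of depth `ℓ` have norm at most `T^(ℓ+1) B^(2ℓ) √d` (`eNorm_network_le`), so the lower
bound on `S` keeps every gate exact. Since each new token has the form of the old ones with a tag
lower than its source's by one, induction applies (`promptTransformer_apply_seq`,
`generate_eq_seq`).

All matrices are block patterns independent of `d`, which gives linear sparsity and bounded entries.
-/

/-- The coordinates of `ℝ^{rd+s}` as `r` blocks of length `d` followed by `s` scalars. -/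
def coordEquiv (r s d : ℕ) : (Fin r × Fin d) ⊕ Fin s ≃ Fin (r * d + s) :=
  (finProdFinEquiv.sumCongr (Equiv.refl _)).trans finSumFinEquiv

variable {r s r' s' d n : ℕ}

/-- Block number `a` of a vector. -/
def blk (h : Fin (r * d + s) → ℝ) (a : Fin r) : Fin d → ℝ :=
  fun k => h (coordEquiv r s d (Sum.inl (a, k)))

/-- Scalar number `t` of a vector. -/
def scl (h : Fin (r * d + s) → ℝ) (t : Fin s) : ℝ := h (coordEquiv r s d (Sum.inr t))

theorem ext_blk_scl {h h' : Fin (r * d + s) → ℝ} (hb : ∀ a k, blk h a k = blk h' a k)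
    (hs : ∀ t, scl h t = scl h' t) : h = h' := by
  funext i
  obtain ⟨x, rfl⟩ := (coordEquiv r s d).surjective i
  rcases x with ⟨a, k⟩ | t
  · exact hb a k
  · exact hs t

theorem sum_blk_scl {M : Type*} [AddCommMonoid M] (f : Fin (r * d + s) → M) :
    ∑ i, f i = ∑ a, ∑ k, f (coordEquiv r s d (Sum.inl (a, k))) +
      ∑ t, f (coordEquiv r s d (Sum.inr t)) := by
  rw [← (coordEquiv r s d).sum_comp, Fintype.sum_sum_type, Fintype.sum_prod_type]

@[simp] theorem blk_add (h h' : Fin (r * d + s) → ℝ) (a : Fin r) :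
    blk (h + h') a = blk h a + blk h' a := rfl

@[simp] theorem scl_add (h h' : Fin (r * d + s) → ℝ) (t : Fin s) :
    scl (h + h') t = scl h t + scl h' t := rfl

@[simp] theorem blk_smul (c : ℝ) (h : Fin (r * d + s) → ℝ) (a : Fin r) :
    blk (c • h) a = c • blk h a := rfl

@[simp] theorem scl_smul (c : ℝ) (h : Fin (r * d + s) → ℝ) (t : Fin s) :
    scl (c • h) t = c * scl h t := rfl

theorem blk_sum {ι : Type*} (S : Finset ι) (f : ι → Fin (r * d + s) → ℝ) (a : Fin r) :
    blk (∑ i ∈ S, f i) a = ∑ i ∈ S, blk (f i) a := by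
  funext k; simp [blk, Finset.sum_apply]

theorem scl_sum {ι : Type*} (S : Finset ι) (f : ι → Fin (r * d + s) → ℝ) (t : Fin s) :
    scl (∑ i ∈ S, f i) t = ∑ i ∈ S, scl (f i) t := by
  simp [scl, Finset.sum_apply]

theorem blk_reluVec (h : Fin (r * d + s) → ℝ) (a : Fin r) (k : Fin d) :
    blk (reluVec h) a k = relu (blk h a k) := rfl

theorem scl_reluVec (h : Fin (r * d + s) → ℝ) (t : Fin s) :
    scl (reluVec h) t = relu (scl h t) := rfl

theorem dotProduct_eq_blk_scl (h h' : Fin (r * d + s) → ℝ) :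
    h ⬝ᵥ h' = ∑ a, blk h a ⬝ᵥ blk h' a + scl h ⬝ᵥ scl h' :=
  sum_blk_scl fun i => h i * h' i

/-! ### Block-pattern matrices -/

/-- The matrix which acts on the blocks through `α`, on the scalars through `β`, and adds to all
entries of a block the combination of the scalars given by `γ`. -/
def pat (d : ℕ) (α : Matrix (Fin r) (Fin r') ℝ) (γ : Matrix (Fin r) (Fin s') ℝ)
    (β : Matrix (Fin s) (Fin s') ℝ) : Matrix (Fin (r * d + s)) (Fin (r' * d + s')) ℝ :=
  (Matrix.fromBlocks (Matrix.of fun p q => if p.2 = q.2 then α p.1 q.1 else 0)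
    (Matrix.of fun p t => γ p.1 t) 0 β).submatrix (coordEquiv r s d).symm (coordEquiv r' s' d).symm

theorem blk_pat_mulVec (α : Matrix (Fin r) (Fin r') ℝ) (γ : Matrix (Fin r) (Fin s') ℝ)
    (β : Matrix (Fin s) (Fin s') ℝ) (h : Fin (r' * d + s') → ℝ) (a : Fin r) (k : Fin d) :
    blk (pat d α γ β *ᵥ h) a k = ∑ b, α a b * blk h b k + (γ *ᵥ scl h) a := by
  simp [blk, scl, pat, Matrix.mulVec, dotProduct, sum_blk_scl]

theorem scl_pat_mulVec (α : Matrix (Fin r) (Fin r') ℝ) (γ : Matrix (Fin r) (Fin s') ℝ)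
    (β : Matrix (Fin s) (Fin s') ℝ) (h : Fin (r' * d + s') → ℝ) :
    scl (pat d α γ β *ᵥ h) = β *ᵥ scl h := by
  funext t
  simp [scl, pat, Matrix.mulVec, dotProduct, sum_blk_scl]

theorem blk_pat_mulVec' (α : Matrix (Fin r) (Fin r') ℝ)
    (β : Matrix (Fin s) (Fin s') ℝ) (h : Fin (r' * d + s') → ℝ) (a : Fin r) :
    blk (pat d α 0 β *ᵥ h) a = ∑ b, α a b • blk h b := by
  funext k
  simp [blk_pat_mulVec, Finset.sum_apply]

/-- Blocks interact only coordinate by coordinate, so a row meets at most one entry per column block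
and one per scalar column. -/
theorem matZeroNorm_pat_le (hd : 0 < d) (α : Matrix (Fin r) (Fin r') ℝ)
    (γ : Matrix (Fin r) (Fin s') ℝ) (β : Matrix (Fin s) (Fin s') ℝ) :
    matZeroNorm (pat d α γ β) ≤ (r * d + s) * (r' + s') := by
  -- For a scalar row the coordinate inside a column block is the dummy `0`: those entries vanish
  -- anyway.
  let f : ((Fin r × Fin d) ⊕ Fin s) × (Fin r' ⊕ Fin s') →
      Fin (r * d + s) × Fin (r' * d + s') := fun p =>
    (coordEquiv r s d p.1, coordEquiv r' s' d (p.2.map (fun b => (b, p.1.elim Prod.snd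
      fun _ => ⟨0, hd⟩)) id))
  have hsub : {p : Fin (r * d + s) × Fin (r' * d + s') | pat d α γ β p.1 p.2 ≠ 0} ⊆
      Set.range f := by
    rintro ⟨i, j⟩ hij
    obtain ⟨x, rfl⟩ := (coordEquiv r s d).surjective i
    obtain ⟨y, rfl⟩ := (coordEquiv r' s' d).surjective j
    rcases y with ⟨b, l⟩ | t
    · rcases x with ⟨a, k⟩ | t
      · have hkl : k = l := by
          by_contra hne
          simp [pat, hne] at hij
        subst hkl
        exact ⟨(Sum.inl (a, k), Sum.inl b), rfl⟩
      · simp [pat] at hij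
    · exact ⟨(x, Sum.inr t), rfl⟩
  calc matZeroNorm (pat d α γ β) ≤ (Set.range f).ncard := Set.ncard_le_ncard hsub
    _ ≤ Nat.card (((Fin r × Fin d) ⊕ Fin s) × (Fin r' ⊕ Fin s')) := by
        rw [← Set.image_univ, ← Set.ncard_univ]
        exact Set.ncard_image_le
    _ = (r * d + s) * (r' + s') := by simp

theorem nnnorm_le_matMaxNorm {a b : ℕ} (A : Matrix (Fin a) (Fin b) ℝ) (i : Fin a) (j : Fin b) :
    ‖A i j‖₊ ≤ matMaxNorm A :=
  Finset.le_sup (f := fun p : Fin a × Fin b => ‖A p.1 p.2‖₊) (Finset.mem_univ (i, j))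

theorem matMaxNorm_pat_le (α : Matrix (Fin r) (Fin r') ℝ)
    (γ : Matrix (Fin r) (Fin s') ℝ) (β : Matrix (Fin s) (Fin s') ℝ) :
    matMaxNorm (pat d α γ β) ≤ matMaxNorm α + matMaxNorm γ + matMaxNorm β := by
  refine Finset.sup_le fun p _ => ?_
  obtain ⟨i, j⟩ := p
  obtain ⟨x, rfl⟩ := (coordEquiv r s d).surjective i
  obtain ⟨y, rfl⟩ := (coordEquiv r' s' d).surjective j
  rcases x with ⟨a, k⟩ | t <;> rcases y with ⟨b, l⟩ | t'
  · by_cases hkl : k = l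
    · simpa [pat, hkl, add_assoc] using le_add_right (nnnorm_le_matMaxNorm α a b)
    · simp [pat, hkl]
  · have := nnnorm_le_matMaxNorm γ a t'
    simpa [pat] using le_add_right (le_add_left this)
  · simp [pat]
  · have := nnnorm_le_matMaxNorm β t t'
    simpa [pat] using le_add_left this

/-! ### Layers of selection heads -/

/-- The data of four attention heads which together add, to the token of the query, the image
under `(αV, βV)` of each key for which the form `X` vanishes, weighted by the form `(α, β)`. -/
structure Selector where
  X : Matrix (Fin 8) (Fin 8) ℝ
  α : Matrix (Fin 4) (Fin 4) ℝ
  β : Matrix (Fin 8) (Fin 8) ℝ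
  αV : Matrix (Fin 4) (Fin 4) ℝ
  βV : Matrix (Fin 8) (Fin 8) ℝ

/-- A dimension-free description of a layer on `ℝ^{4d+8}`. -/
structure LayerSpec where
  sel : Fin 2 → Selector
  r : ℕ
  s : ℕ
  s_pos : 0 < s
  α₁ : Matrix (Fin r) (Fin 4) ℝ
  γ₁ : Matrix (Fin r) (Fin 8) ℝ
  β₁ : Matrix (Fin s) (Fin 8) ℝ
  α₂ : Matrix (Fin 4) (Fin r) ℝ
  β₂ : Matrix (Fin 8) (Fin s) ℝ

/-- Signs of the scale in the four heads of a selector. -/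
def scaleSign : Fin 4 → ℝ := ![1, 1, -1, -1]

/-- Whether the weight is present in the four heads of a selector. -/
def weightSign : Fin 4 → ℝ := ![1, 0, 1, 0]

/-- Signs of the values of the four heads of a selector. -/
def valueSign : Fin 4 → ℝ := ![1, -1, -1, 1]

/-- The form on the scalars in the heads of a selector. -/
def Selector.scalarForm (g : Selector) (m : Fin 4) : Matrix (Fin 8) (Fin 8) ℝ :=
  (2 : ℝ) • g.X + scaleSign m • Matrix.single 4 5 1 + weightSign m • g.β

/-- The layer on `ℝ^{4d+8}` with a given description. -/
def LayerSpec.toLayer (σ : LayerSpec) (d : ℕ) : Layer (4 * d + 8) where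
  heads := 2 * 4
  heads_pos := by norm_num
  width := σ.r * d + σ.s
  width_pos := Nat.add_pos_right _ σ.s_pos
  Q m := pat d (weightSign (finProdFinEquiv.symm m).2 • (σ.sel (finProdFinEquiv.symm m).1).α) 0
    ((σ.sel (finProdFinEquiv.symm m).1).scalarForm (finProdFinEquiv.symm m).2)
  K _ := pat d 1 0 1
  V m := pat d (valueSign (finProdFinEquiv.symm m).2 • (σ.sel (finProdFinEquiv.symm m).1).αV) 0
    (valueSign (finProdFinEquiv.symm m).2 • (σ.sel (finProdFinEquiv.symm m).1).βV)
  W₁ := pat d σ.α₁ σ.γ₁ σ.β₁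
  W₂ := pat d σ.α₂ 0 σ.β₂

/-! ### Size bounds uniform in the dimension -/

theorem exists_maxNorm_le {l : ℕ} (σ : Fin l → LayerSpec) :
    ∃ C : ℝ≥0, ∀ d, Transformer.maxNorm (fun k => (σ k).toLayer d) ≤ C := by
  have h : ∀ k, ∃ C : ℝ≥0, ∀ d, matMaxNorm ((σ k).toLayer d).W₁ ⊔ matMaxNorm ((σ k).toLayer d).W₂ ⊔
      (Finset.univ.sup fun m => matMaxNorm (((σ k).toLayer d).Q m) ⊔
        matMaxNorm (((σ k).toLayer d).K m) ⊔ matMaxNorm (((σ k).toLayer d).V m)) ≤ C := by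
    intro k
    have hm : ∀ m : Fin (2 * 4), ∃ C : ℝ≥0, ∀ d, matMaxNorm (((σ k).toLayer d).Q m) ⊔
        matMaxNorm (((σ k).toLayer d).K m) ⊔ matMaxNorm (((σ k).toLayer d).V m) ≤ C := fun m =>
      ⟨_, fun d => sup_le_sup (sup_le_sup (matMaxNorm_pat_le _ _ _) (matMaxNorm_pat_le _ _ _))
        (matMaxNorm_pat_le _ _ _)⟩
    choose C hC using hm
    refine ⟨_, fun d => sup_le_sup (sup_le_sup (matMaxNorm_pat_le _ _ _) (matMaxNorm_pat_le _ _ _))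
      (show _ ≤ Finset.univ.sup C from Finset.sup_mono_fun fun m _ => hC m d)⟩
  choose C hC using h
  exact ⟨Finset.univ.sup C, fun d => Finset.sup_mono_fun fun k _ => hC k d⟩

theorem exists_zeroNorm_le {l : ℕ} (σ : Fin l → LayerSpec) :
    ∃ C : ℕ, ∀ d, 0 < d → Transformer.zeroNorm (fun k => (σ k).toLayer d) ≤ C * d := by
  have hpat : ∀ {r s r' s' d : ℕ} (_ : 0 < d) (α : Matrix (Fin r) (Fin r') ℝ)
      (γ : Matrix (Fin r) (Fin s') ℝ) (β : Matrix (Fin s) (Fin s') ℝ),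
      matZeroNorm (pat d α γ β) ≤ (r + s) * (r' + s') * d := fun {r s r' s' d} hd α γ β =>
    (matZeroNorm_pat_le hd α γ β).trans (by
      have : r * d + s ≤ (r + s) * d := by nlinarith
      calc _ ≤ (r + s) * d * (r' + s') := Nat.mul_le_mul_right _ this
        _ = _ := by ring)
  refine ⟨∑ k, (((σ k).r + (σ k).s) * (4 + 8) + (4 + 8) * ((σ k).r + (σ k).s) +
    ∑ _m : Fin (2 * 4), ((4 + 8) * (4 + 8) + (4 + 8) * (4 + 8) + (4 + 8) * (4 + 8))),
    fun d hd => ?_⟩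
  rw [Finset.sum_mul]
  refine Finset.sum_le_sum fun k _ => ?_
  rw [add_mul, add_mul, Finset.sum_mul]
  refine Nat.add_le_add (Nat.add_le_add (hpat hd _ _ _) (hpat hd _ _ _))
    (Finset.sum_le_sum fun m _ => ?_)
  rw [add_mul, add_mul]
  exact Nat.add_le_add (Nat.add_le_add (hpat hd _ _ _) (hpat hd _ _ _)) (hpat hd _ _ _)

theorem exists_width_le {l : ℕ} (σ : Fin l → LayerSpec) :
    ∃ C : ℕ, ∀ d, 0 < d → ∀ k, ((σ k).toLayer d).width ≤ C * d := by
  refine ⟨∑ k, ((σ k).r + (σ k).s), fun d hd k => ?_⟩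
  have h1 : (σ k).r + (σ k).s ≤ ∑ k, ((σ k).r + (σ k).s) :=
    Finset.single_le_sum (f := fun k => (σ k).r + (σ k).s) (fun _ _ => Nat.zero_le _)
      (Finset.mem_univ k)
  have h2 : ((σ k).toLayer d).width ≤ ((σ k).r + (σ k).s) * d := by
    change (σ k).r * d + (σ k).s ≤ _
    nlinarith
  exact h2.trans (Nat.mul_le_mul_right _ h1)

end

section

variable {r s r' s' d n : ℕ}

/-! ### The selection gate -/

theorem relu_of_nonneg {x : ℝ} (h : 0 ≤ x) : relu x = x := max_eq_right h

theorem relu_of_nonpos {x : ℝ} (h : x ≤ 0) : relu x = 0 := max_eq_left h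

theorem relu_sub_relu_neg (x : ℝ) : relu x - relu (-x) = x := by
  rcases le_total 0 x with h | h
  · rw [relu_of_nonneg h, relu_of_nonpos (by linarith)]; ring
  · rw [relu_of_nonpos h, relu_of_nonneg (by linarith)]; ring

/-- A combination of four ReLUs which returns the weight `a` at `x = 0` and `0` at the nonzero
multiples of the scale `S`. -/
def gate (x S a : ℝ) : ℝ :=
  relu (2 * x + S + a) - relu (2 * x + S) - relu (2 * x - S + a) + relu (2 * x - S)

/-- At `x = 0` the two ReLUs with `+S` are active and the two with `-S` are not. For `x ≠ 0` the
factor `2` gives `|2 S x| ≥ 2 S ≥ S + |a|`, so all four arguments lie on the same side of `0` and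
the terms cancel. -/
theorem gate_mul_intCast {S a : ℝ} (hS : 0 ≤ S) (ha : |a| ≤ S) (x : ℤ) :
    gate (S * x) S a = if x = 0 then a else 0 := by
  have ha' := abs_le.1 ha
  unfold gate
  split_ifs with h
  · subst h
    rw [relu_of_nonneg (x := _ + S + a), relu_of_nonneg (x := _ + S),
      relu_of_nonpos (x := _ - S + a), relu_of_nonpos (x := _ - S)] <;> push_cast <;> linarith
  · rcases lt_or_gt_of_ne h with h | h
    · have hx : (x : ℝ) ≤ -1 := by exact_mod_cast Int.le_sub_one_of_lt h
      have : S * x ≤ S * (-1) := mul_le_mul_of_nonneg_left hx hS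
      rw [relu_of_nonpos (x := _ + S + a), relu_of_nonpos (x := _ + S),
        relu_of_nonpos (x := _ - S + a), relu_of_nonpos (x := _ - S)] <;> linarith
    · have hx : (1 : ℝ) ≤ x := by exact_mod_cast h
      have : S * 1 ≤ S * x := mul_le_mul_of_nonneg_left hx hS
      rw [relu_of_nonneg (x := _ + S + a), relu_of_nonneg (x := _ + S),
        relu_of_nonneg (x := _ - S + a), relu_of_nonneg (x := _ - S)] <;> linarith

/-! ### The action of a layer -/

/-- The bilinear form of a matrix on the scalars, the query coming first. -/
def form {s : ℕ} (A : Matrix (Fin s) (Fin s) ℝ) (q k : Fin s → ℝ) : ℝ := (A *ᵥ q) ⬝ᵥ k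

@[simp] theorem form_zero (q k : Fin s → ℝ) : form 0 q k = 0 := by simp [form]

@[simp] theorem form_add (A A' : Matrix (Fin s) (Fin s) ℝ) (q k : Fin s → ℝ) :
    form (A + A') q k = form A q k + form A' q k := by
  simp [form, Matrix.add_mulVec, add_dotProduct]

@[simp] theorem form_smul (c : ℝ) (A : Matrix (Fin s) (Fin s) ℝ) (q k : Fin s → ℝ) :
    form (c • A) q k = c * form A q k := by
  simp [form, Matrix.smul_mulVec, smul_dotProduct]

@[simp] theorem form_single (i j : Fin s) (c : ℝ) (q k : Fin s → ℝ) :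
    form (Matrix.single i j c) q k = c * q j * k i := by
  simp [form, Matrix.mulVec, dotProduct, Matrix.single_apply, ite_and, Finset.sum_ite_eq]

/-- The bilinear form of a matrix on the blocks, the query coming first. -/
def blkForm (α : Matrix (Fin r) (Fin r) ℝ) (h h' : Fin (r * d + s) → ℝ) : ℝ :=
  ∑ a, (∑ b, α a b • blk h b) ⬝ᵥ blk h' a

@[simp] theorem blkForm_zero (h h' : Fin (r * d + s) → ℝ) : blkForm 0 h h' = 0 := by
  simp [blkForm]

@[simp] theorem blkForm_smul (c : ℝ) (α : Matrix (Fin r) (Fin r) ℝ)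
    (h h' : Fin (r * d + s) → ℝ) : blkForm (c • α) h h' = c * blkForm α h h' := by
  simp [blkForm, mul_smul, ← Finset.smul_sum, ← Finset.mul_sum, smul_dotProduct]

@[simp] theorem blkForm_single (a b : Fin r) (h h' : Fin (r * d + s) → ℝ) :
    blkForm (Matrix.single a b 1) h h' = blk h b ⬝ᵥ blk h' a := by
  rw [blkForm, Finset.sum_eq_single a]
  · simp [Matrix.single_apply]
  · intro c _ hc
    simp [hc.symm]
  · simp

/-- The key matrix is the identity, so the query matrix carries the whole bilinear form. -/
theorem pat_mulVec_dotProduct (α : Matrix (Fin r) (Fin r) ℝ) (β : Matrix (Fin s) (Fin s) ℝ)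
    (h h' : Fin (r * d + s) → ℝ) :
    (pat d α 0 β *ᵥ h) ⬝ᵥ (pat d 1 0 1 *ᵥ h') = blkForm α h h' + form β (scl h) (scl h') := by
  have h1 : pat d 1 0 1 *ᵥ h' = h' := by
    refine ext_blk_scl (fun a k => ?_) fun t => ?_
    · simp [blk_pat_mulVec, Matrix.one_apply]
    · rw [scl_pat_mulVec]; simp
  rw [h1, dotProduct_eq_blk_scl, scl_pat_mulVec]
  simp only [blk_pat_mulVec']
  rfl

/-- The weight which a selector gives to the key `h'` for the query `h`. -/
def Selector.weight (g : Selector) (h h' : Fin (4 * d + 8) → ℝ) : ℝ :=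
  gate (form g.X (scl h) (scl h')) (scl h 5 * scl h' 4)
    (blkForm g.α h h' + form g.β (scl h) (scl h'))

/-- The value which a selector reads off a key. -/
def Selector.value (g : Selector) (h : Fin (4 * d + 8) → ℝ) : Fin (4 * d + 8) → ℝ :=
  pat d g.αV 0 g.βV *ᵥ h

theorem Selector.value_smul (g : Selector) (c : ℝ) (h : Fin (4 * d + 8) → ℝ) :
    pat d (c • g.αV) 0 (c • g.βV) *ᵥ h = c • g.value h := by
  refine ext_blk_scl (fun a k => ?_) fun t => ?_
  · simp [Selector.value, blk_pat_mulVec', mul_assoc, Finset.mul_sum]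
  · simp [Selector.value, scl_pat_mulVec, Matrix.smul_mulVec]

/-- The signs of `valueSign` sit in the value matrices, so the four heads share one value and their
ReLU scores combine to the gate. -/
theorem Selector.sum_heads (g : Selector) (h h' : Fin (4 * d + 8) → ℝ) :
    ∑ m : Fin 4, relu ((pat d (weightSign m • g.α) 0 (g.scalarForm m) *ᵥ h) ⬝ᵥ
        (pat d 1 0 1 *ᵥ h')) • (pat d (valueSign m • g.αV) 0 (valueSign m • g.βV) *ᵥ h') =
      g.weight h h' • g.value h' := by
  simp only [pat_mulVec_dotProduct, g.value_smul, smul_smul, ← Finset.sum_smul]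
  congr 1
  simp only [Fin.sum_univ_four, Selector.scalarForm, form_add, form_smul, form_single,
    blkForm_smul, weightSign, scaleSign, valueSign, Selector.weight, gate, Matrix.cons_val]
  ring_nf

theorem attn_toLayer (σ : LayerSpec) (H : TokenSeq (4 * d + 8) n) (j : Fin n) :
    (σ.toLayer d).attn H j = H j + (∑ j', (σ.sel 0).weight (H j) (H j') • (σ.sel 0).value (H j') +
      ∑ j', (σ.sel 1).weight (H j) (H j') • (σ.sel 1).value (H j')) := by
  have h : ∀ p, ∑ j', (σ.sel p).weight (H j) (H j') • (σ.sel p).value (H j') =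
      ∑ m : Fin 4, ∑ j', relu ((pat d (weightSign m • (σ.sel p).α) 0 ((σ.sel p).scalarForm m) *ᵥ
        H j) ⬝ᵥ (pat d 1 0 1 *ᵥ H j')) •
        (pat d (valueSign m • (σ.sel p).αV) 0 (valueSign m • (σ.sel p).βV) *ᵥ H j') := by
    intro p
    rw [Finset.sum_comm]
    exact Finset.sum_congr rfl fun j' _ => ((σ.sel p).sum_heads _ _).symm
  rw [h, h, ← Fin.sum_univ_two fun p => ∑ m : Fin 4, ∑ j', relu ((pat d (weightSign m •
    (σ.sel p).α) 0 ((σ.sel p).scalarForm m) *ᵥ H j) ⬝ᵥ (pat d 1 0 1 *ᵥ H j')) •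
    (pat d (valueSign m • (σ.sel p).αV) 0 (valueSign m • (σ.sel p).βV) *ᵥ H j'),
    ← Fintype.sum_prod_type']
  change H j + _ = _
  congr 1
  exact (finProdFinEquiv.symm.sum_comp fun p : Fin 2 × Fin 4 => ∑ j', relu ((pat d
    (weightSign p.2 • (σ.sel p.1).α) 0 ((σ.sel p.1).scalarForm p.2) *ᵥ H j) ⬝ᵥ
    (pat d 1 0 1 *ᵥ H j')) •
    (pat d (valueSign p.2 • (σ.sel p.1).αV) 0 (valueSign p.2 • (σ.sel p.1).βV) *ᵥ H j'))

theorem blk_attn_toLayer (σ : LayerSpec) (H : TokenSeq (4 * d + 8) n) (j : Fin n) (a : Fin 4) :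
    blk ((σ.toLayer d).attn H j) a = blk (H j) a +
      (∑ j', (σ.sel 0).weight (H j) (H j') • ∑ b, (σ.sel 0).αV a b • blk (H j') b +
       ∑ j', (σ.sel 1).weight (H j) (H j') • ∑ b, (σ.sel 1).αV a b • blk (H j') b) := by
  simp [attn_toLayer, blk_sum, Selector.value, blk_pat_mulVec']

theorem scl_attn_toLayer (σ : LayerSpec) (H : TokenSeq (4 * d + 8) n) (j : Fin n) (t : Fin 8) :
    scl ((σ.toLayer d).attn H j) t = scl (H j) t +
      (∑ j', (σ.sel 0).weight (H j) (H j') * ((σ.sel 0).βV *ᵥ scl (H j')) t +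
       ∑ j', (σ.sel 1).weight (H j) (H j') * ((σ.sel 1).βV *ᵥ scl (H j')) t) := by
  simp [attn_toLayer, scl_sum, Selector.value, scl_pat_mulVec]

theorem blk_ffn_toLayer (σ : LayerSpec) (H : TokenSeq (4 * d + 8) n) (j : Fin n) (a : Fin 4)
    (k : Fin d) :
    blk ((σ.toLayer d).ffn H j) a k = blk (H j) a k +
      ∑ ρ, σ.α₂ a ρ * relu (∑ b, σ.α₁ ρ b * blk (H j) b k + (σ.γ₁ *ᵥ scl (H j)) ρ) := by
  change blk (H j + pat d σ.α₂ 0 σ.β₂ *ᵥ reluVec (pat d σ.α₁ σ.γ₁ σ.β₁ *ᵥ H j)) a k = _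
  simp [blk_pat_mulVec, blk_reluVec]

theorem scl_ffn_toLayer (σ : LayerSpec) (H : TokenSeq (4 * d + 8) n) (j : Fin n) (t : Fin 8) :
    scl ((σ.toLayer d).ffn H j) t = scl (H j) t +
      ∑ τ, σ.β₂ t τ * relu ((σ.β₁ *ᵥ scl (H j)) τ) := by
  change scl (H j + pat d σ.α₂ 0 σ.β₂ *ᵥ reluVec (pat d σ.α₁ σ.γ₁ σ.β₁ *ᵥ H j)) t = _
  rw [scl_add, scl_pat_mulVec]
  simp [Matrix.mulVec, dotProduct, scl_reluVec, scl_pat_mulVec]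

end

section

variable {r s r' s' d n : ℕ}

/-! ### Tokens by blocks and scalars -/

/-- The vector with given blocks and scalars. -/
def mkVec (b : Fin r → Fin d → ℝ) (t : Fin s → ℝ) : Fin (r * d + s) → ℝ := fun i =>
  ((coordEquiv r s d).symm i).elim (fun p => b p.1 p.2) t

@[simp] theorem blk_mkVec (b : Fin r → Fin d → ℝ) (t : Fin s → ℝ) : blk (mkVec b t) = b := by
  funext a k; simp [blk, mkVec]

@[simp] theorem scl_mkVec (b : Fin r → Fin d → ℝ) (t : Fin s → ℝ) : scl (mkVec b t) = t := by
  funext a; simp [scl, mkVec]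

theorem eq_mkVec {h : Fin (r * d + s) → ℝ} {b : Fin r → Fin d → ℝ} {t : Fin s → ℝ}
    (hb : ∀ a, blk h a = b a) (ht : ∀ i, scl h i = t i) : h = mkVec b t :=
  ext_blk_scl (fun a k => by rw [hb, blk_mkVec]) fun i => by rw [ht, scl_mkVec]

theorem coordEquiv_inl_val (a : Fin r) (k : Fin d) :
    ((coordEquiv r s d (Sum.inl (a, k)) : Fin (r * d + s)) : ℕ) = k + d * a := by
  simp [coordEquiv]

theorem coordEquiv_inr_val (t : Fin s) :
    ((coordEquiv r s d (Sum.inr t) : Fin (r * d + s)) : ℕ) = r * d + t := by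
  simp [coordEquiv]

theorem blk_ffn_mk (sel : Fin 2 → Selector) (hs : 0 < s) (α₁ : Matrix (Fin r) (Fin 4) ℝ)
    (γ₁ : Matrix (Fin r) (Fin 8) ℝ) (β₁ : Matrix (Fin s) (Fin 8) ℝ) (α₂ : Matrix (Fin 4) (Fin r) ℝ)
    (β₂ : Matrix (Fin 8) (Fin s) ℝ) {H : TokenSeq (4 * d + 8) n} {j : Fin n}
    {b : Fin 4 → Fin d → ℝ} {t : Fin 8 → ℝ} (h : H j = mkVec b t) (a : Fin 4) (k : Fin d) :
    blk (((⟨sel, r, s, hs, α₁, γ₁, β₁, α₂, β₂⟩ : LayerSpec).toLayer d).ffn H j) a k =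
      b a k + ∑ ρ : Fin r, α₂ a ρ * relu (∑ c, α₁ ρ c * b c k + ∑ i, γ₁ ρ i * t i) := by
  rw [blk_ffn_toLayer, h, blk_mkVec, scl_mkVec]
  rfl

theorem scl_ffn_mk (sel : Fin 2 → Selector) (hs : 0 < s) (α₁ : Matrix (Fin r) (Fin 4) ℝ)
    (γ₁ : Matrix (Fin r) (Fin 8) ℝ) (β₁ : Matrix (Fin s) (Fin 8) ℝ) (α₂ : Matrix (Fin 4) (Fin r) ℝ)
    (β₂ : Matrix (Fin 8) (Fin s) ℝ) {H : TokenSeq (4 * d + 8) n} {j : Fin n}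
    {b : Fin 4 → Fin d → ℝ} {t : Fin 8 → ℝ} (h : H j = mkVec b t) (i : Fin 8) :
    scl (((⟨sel, r, s, hs, α₁, γ₁, β₁, α₂, β₂⟩ : LayerSpec).toLayer d).ffn H j) i =
      t i + ∑ τ : Fin s, β₂ i τ * relu (∑ c, β₁ τ c * t c) := by
  rw [scl_ffn_toLayer, h, scl_mkVec]
  rfl

theorem token_posEnc (u : Fin d → ℝ) (w : ℤ) (j : ℕ) (S : ℝ) :
    token u (posEnc d w j S) = mkVec ![u, 0, 0, 0] ![0, 0, 0, 0, 1, S, S * w, S * j] := by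
  refine eq_mkVec (fun a => funext fun k => ?_) fun t => ?_
  · have hk := k.2
    have hv := coordEquiv_inl_val (s := 8) a k
    by_cases ha : a = 0
    · subst ha
      simp only [Fin.coe_ofNat_eq_mod, Nat.zero_mod, mul_zero, add_zero] at hv
      have : (coordEquiv 4 8 d (Sum.inl (0, k)) : Fin (4 * d + 8)) = ⟨k, by omega⟩ := Fin.ext hv
      simp [blk, token, this]
    · have h1 : 1 ≤ (a : ℕ) := Nat.one_le_iff_ne_zero.2 fun h => ha (Fin.ext h)
      have h2 : d * 1 ≤ d * (a : ℕ) := Nat.mul_le_mul_left _ h1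
      have h3 : d * (a : ℕ) ≤ d * 3 := Nat.mul_le_mul_left _ (by omega)
      have hz : (![u, 0, 0, 0] : Fin 4 → Fin d → ℝ) a k = 0 := by
        fin_cases a <;> simp at ha ⊢
      rw [hz]
      simp only [blk, token, posEnc, hv]
      rw [dif_neg (by omega), if_neg (by omega), if_neg (by omega), if_neg (by omega),
        if_neg (by omega)]
  · have hv := coordEquiv_inr_val (r := 4) (d := d) t
    simp only [scl, token, posEnc, hv]
    rw [dif_neg (by omega)]
    fin_cases t <;> simp only [Fin.reduceFinMk] <;>
      split_ifs <;> first | omega | rfl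

theorem sum_single_smul {M : Type*} [AddCommMonoid M] [Module ℝ M] (a b : Fin r) (c : ℝ)
    (a' : Fin r) (x : Fin r → M) :
    ∑ b', (Matrix.single a b c : Matrix (Fin r) (Fin r) ℝ) a' b' • x b' =
      if a = a' then c • x b else 0 := by
  split_ifs with h
  · subst h
    rw [Finset.sum_eq_single b]
    · simp
    · intro b' _ hb; simp [hb.symm]
    · simp
  · simp [h]

theorem single_mulVec_apply (a b : Fin s) (c : ℝ) (a' : Fin s) (x : Fin s → ℝ) :
    ((Matrix.single a b c : Matrix (Fin s) (Fin s) ℝ) *ᵥ x) a' = if a = a' then c * x b else 0 :=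
  sum_single_smul a b c a' x

theorem sum_fin_ite_eq {M : Type*} [AddCommMonoid M] (m : ℕ) (F : ℕ → M) :
    ∑ j : Fin n, (if (j : ℕ) = m then F j else 0) = if m < n then F m else 0 := by
  rw [Fin.sum_univ_eq_sum_range (fun j => if j = m then F j else 0), Finset.sum_ite_eq']
  simp

/-! ### The layers of the transformer

The blocks of a token are its embedding, the embedding of the next token, the input of the current
layer of the virtual network, and the embedding masked by the tag being `1`. The scalars are `S N`,
the tag of the next token, the tag of the source token, the sum collected by `sumSel`, and then
`1`, `S`, `S w`, `S j`. -/

/-- The selector which reads nothing. -/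
def zeroSel : Selector := ⟨0, 0, 0, 0, 0⟩

/-- Counts the tokens with tag `0`. -/
def countSel : Selector := ⟨.single 6 4 1, 0, .single 4 4 1, 0, .single 0 5 1⟩

/-- Copies embedding and tag of the next token. -/
def nextSel : Selector :=
  -- In `single i j`, `i` is the key coordinate and `j` the query coordinate; the condition reads `S
  -- (j' - j - 1) = 0`.
  ⟨.single 7 4 1 + .single 4 7 (-1) + .single 4 5 (-1), 0, .single 4 4 1, .single 1 0 1,
    .single 1 6 1⟩

/-- Copies embedding and tag of the token which lies `N - 1` positions back. -/
def sourceSel : Selector :=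
  ⟨.single 7 4 1 + .single 4 7 (-1) + .single 4 5 (-1) + .single 4 0 1, 0, .single 4 4 1,
    .single 2 0 1, .single 2 6 1⟩

/-- Sums the outer products of the token pairs which belong to the current layer of the virtual
network, applied to its input. -/
def pairSel : Selector :=
  -- The condition is `S (w' - 1 + 2 w) = 0` with `w` the source tag: `w = -(ℓ-1)` selects the key
  -- tag `2ℓ-1`.
  ⟨.single 6 4 1 + .single 4 5 (-1) + .single 4 2 2, .single 1 2 1, 0, .single 1 0 1, 0⟩

/-- Sums the inner products of the input with the embeddings of the tokens with tag `1`. -/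
def sumSel : Selector := ⟨0, .single 3 2 1, 0, 0, .single 3 4 1⟩

/-- Reads the token `N` positions back, provided that its tag is `1`. -/
def backSel : Selector :=
  ⟨.single 7 4 1 + .single 4 7 (-1) + .single 4 0 1, 0, .single 4 3 1, .single 1 3 1, 0⟩

/-- The layer which does nothing. -/
def idSpec : LayerSpec := ⟨![zeroSel, zeroSel], 1, 1, one_pos, 0, 0, 0, 0, 0⟩

/-- The layer which collects information about the neighbouring token. -/
def neighbourSpec : LayerSpec where
  sel := ![countSel, nextSel]
  r := 10
  s := 1
  s_pos := one_pos
  -- Rows 0–3 gate the next embedding by "tag rises by one", rows 4–7 gate the embedding by "tag is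
  -- `1`", and rows 8–9 rebuild the ungated next embedding in order to subtract it.
  α₁ := !![0, 1, 0, 0; 0, 0, 0, 0; 0, 1, 0, 0; 0, 0, 0, 0; 1, 0, 0, 0; 0, 0, 0, 0; 1, 0, 0, 0;
    0, 0, 0, 0; 0, 1, 0, 0; 0, -1, 0, 0]
  γ₁ := !![0, 2, 0, 0, 0, -1, -2, 0; 0, 2, 0, 0, 0, -1, -2, 0; 0, 2, 0, 0, 0, -3, -2, 0;
    0, 2, 0, 0, 0, -3, -2, 0; 0, 0, 0, 0, 0, -1, 2, 0; 0, 0, 0, 0, 0, -1, 2, 0;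
    0, 0, 0, 0, 0, -3, 2, 0; 0, 0, 0, 0, 0, -3, 2, 0; 0, 0, 0, 0, 0, 0, 0, 0;
    0, 0, 0, 0, 0, 0, 0, 0]
  β₁ := 0
  α₂ := !![0, 0, 0, 0, 0, 0, 0, 0, 0, 0; 1, -1, -1, 1, 0, 0, 0, 0, -1, 1;
    0, 0, 0, 0, 0, 0, 0, 0, 0, 0; 0, 0, 0, 0, 1, -1, -1, 1, 0, 0]
  β₂ := 0

/-- The layer which fetches the input of the current layer of the virtual network. -/
def inputSpec : LayerSpec where
  sel := ![sourceSel, zeroSel]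
  r := 1
  s := 1
  s_pos := one_pos
  α₁ := !![0, 0, -1, 0]
  γ₁ := 0
  β₁ := 0
  α₂ := !![0; 0; 1; 0]
  β₂ := 0

/-- The layer which applies the weight matrix. -/
def weightSpec : LayerSpec := ⟨![pairSel, sumSel], 1, 1, one_pos, 0, 0, 0, 0, 0⟩

/-- The layer which adds the contribution of the last prompt token and forms the new token. -/
def outputSpec : LayerSpec where
  sel := ![backSel, zeroSel]
  r := 5
  s := 6
  s_pos := by norm_num
  α₁ := !![1, 0, 0, 0; -1, 0, 0, 0; 0, 1, 0, 0; 0, -1, 0, 0; 0, 0, 1, 0]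
  γ₁ := 0
  -- The signs are such that, for nonpositive tags, each ReLU of a tag equals its argument;
  -- auxiliary scalars are cleared, the tag becomes the source tag minus one, and the position grows
  -- by one.
  β₁ := !![1, 0, 0, 0, 0, 0, 0, 0; 0, 0, -1, 0, 0, 0, 0, 0; 0, 0, 0, 1, 0, 0, 0, 0;
    0, 0, 0, -1, 0, 0, 0, 0; 0, 0, 0, 0, 0, 0, -1, 0; 0, 0, 0, 0, 0, 1, 0, 0]
  α₂ := !![-1, 1, 1, -1, 0; 0, 0, -1, 1, 0; 0, 0, 0, 0, -1; 0, 0, 0, 0, 0]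
  β₂ := !![-1, 0, 0, 0, 0, 0; 0, 0, 0, 0, 0, 0; 0, 1, 0, 0, 0, 0; 0, 0, -1, 1, 0, 0;
    0, 0, 0, 0, 0, 0; 0, 0, 0, 0, 0, 0; 0, -1, 0, 0, 1, -1; 0, 0, 0, 0, 0, 1]

/-! ### Effect of each layer on a token sequence -/

@[simp] theorem zeroSel_weight (h h' : Fin (4 * d + 8) → ℝ) : zeroSel.weight h h' = 0 := by
  simp [Selector.weight, zeroSel, gate]

theorem ffn_eq_self (σ : LayerSpec) (hα : σ.α₂ = 0) (hβ : σ.β₂ = 0)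
    (H : TokenSeq (4 * d + 8) n) : (σ.toLayer d).ffn H = H := by
  funext j
  refine ext_blk_scl (fun a k => ?_) fun t => ?_
  · simp [blk_ffn_toLayer, hα]
  · simp [scl_ffn_toLayer, hβ]

theorem idSpec_apply (H : TokenSeq (4 * d + 8) n) : (idSpec.toLayer d).apply H = H := by
  rw [Layer.apply, ffn_eq_self _ rfl rfl]
  funext j
  simp [attn_toLayer, idSpec]

section

variable {S : ℝ} {q : Fin n}

theorem neighbourSpec_attn (hS : 1 ≤ S) (U : ℕ → Fin d → ℝ) (W : ℕ → ℤ)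
    {H : TokenSeq (4 * d + 8) n}
    (hH : ∀ j, H j = token (U j) (posEnc d (W j) (j + 1) S)) (j : Fin n) :
    (neighbourSpec.toLayer d).attn H j =
      mkVec ![U j, if (j : ℕ) + 1 < n then U (j + 1) else 0, 0, 0]
        ![S * (∑ j : Fin n, if W j = 0 then 1 else 0 : ℕ),
          S * (if (j : ℕ) + 1 < n then W (j + 1) else 0 : ℤ), 0, 0, 1, S, S * W j,
          S * ((j : ℕ) + 1)] := by
  have h0 : ∀ j', countSel.weight (H j) (H j') = if W j' = 0 then 1 else 0 := by
    intro j'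
    have := gate_mul_intCast (S := S) (a := 1) (by linarith) (by simpa using hS) (W j')
    simpa [Selector.weight, countSel, hH, token_posEnc] using this
  have h1 : ∀ j', nextSel.weight (H j) (H j') = if (j' : ℕ) = j + 1 then 1 else 0 := by
    intro j'
    have := gate_mul_intCast (S := S) (a := 1) (by linarith) (by simpa using hS)
      ((j' : ℤ) - j - 1)
    have e : (j' : ℤ) - j - 1 = 0 ↔ (j' : ℕ) = j + 1 := by omega
    simp only [e] at this
    rw [← this]
    simp only [Selector.weight, nextSel, hH, token_posEnc, scl_mkVec, form_add,
      form_single, blkForm_zero, Matrix.cons_val]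
    push_cast
    ring_nf
  have hb := sum_fin_ite_eq (n := n) (j + 1) fun i => U i
  have ht := sum_fin_ite_eq (n := n) (j + 1) fun i => S * (W i : ℝ)
  refine eq_mkVec (fun a => ?_) fun t => ?_
  · rw [blk_attn_toLayer]
    simp only [neighbourSpec, Matrix.cons_val_zero, Matrix.cons_val_one, h0, h1]
    simp only [countSel, nextSel, sum_single_smul, hH, token_posEnc, blk_mkVec, ite_smul,
      one_smul, zero_smul, Matrix.zero_apply, Finset.sum_const_zero, smul_zero, zero_add]
    fin_cases a <;> simp [hb]
  · rw [scl_attn_toLayer]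
    simp only [neighbourSpec, Matrix.cons_val_zero, Matrix.cons_val_one, h0, h1]
    simp only [countSel, nextSel, single_mulVec_apply, hH, token_posEnc, scl_mkVec, ite_mul,
      one_mul, zero_mul]
    fin_cases t <;> simp [ht, ← Finset.sum_filter, mul_comm]

theorem neighbourSpec_apply (hS : 1 ≤ S) (U : ℕ → Fin d → ℝ) (W : ℕ → ℤ)
    (hU : ∀ j < n, ∀ k, |U j k| ≤ S) {H : TokenSeq (4 * d + 8) n}
    (hH : ∀ j, H j = token (U j) (posEnc d (W j) (j + 1) S)) (j : Fin n) :
    (neighbourSpec.toLayer d).apply H j =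
      mkVec ![U j, if (j : ℕ) + 1 < n ∧ W (j + 1) = W j + 1 then U (j + 1) else 0, 0,
          if W j = 1 then U j else 0]
        ![S * (∑ j : Fin n, if W j = 0 then 1 else 0 : ℕ),
          S * (if (j : ℕ) + 1 < n then W (j + 1) else 0 : ℤ), 0, 0, 1, S, S * W j,
          S * ((j : ℕ) + 1)] := by
  have hG := neighbourSpec_attn hS U W hH j
  have hS0 : 0 ≤ S := by linarith
  refine eq_mkVec (fun a => funext fun k => ?_) fun t => ?_
  · rw [Layer.apply]
    unfold neighbourSpec at hG ⊢
    rw [blk_ffn_mk _ _ _ _ _ _ _ hG]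
    have hA : |(if (j : ℕ) + 1 < n then U (j + 1) else 0) k| ≤ S := by
      split_ifs with h
      · exact hU _ h k
      · simpa using hS0
    have g1 := gate_mul_intCast hS0 hA ((if (j : ℕ) + 1 < n then W (j + 1) else 0 : ℤ) - W j - 1)
    have g2 := gate_mul_intCast hS0 (hU j j.2 k) (W j - 1)
    generalize hA0 : (if (j : ℕ) + 1 < n then U (j + 1) else 0) = A at g1
    generalize hW0 : (if (j : ℕ) + 1 < n then W (j + 1) else 0 : ℤ) = w at g1
    have hr := relu_sub_relu_neg (A k)
    have e1 : (if (j : ℕ) + 1 < n ∧ W (j + 1) = W j + 1 then U (j + 1) else 0) k =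
        if w - W j - 1 = 0 then A k else 0 := by
      subst hA0 hW0
      by_cases h : (j : ℕ) + 1 < n
      · have : W (j + 1) - W j - 1 = 0 ↔ W (j + 1) = W j + 1 := by omega
        simp only [h, true_and, if_true, this]
        split_ifs <;> rfl
      · simp [h]
    have e2 : (if W j = 1 then U j else 0) k = if W j - 1 = 0 then U j k else 0 := by
      have : W j - 1 = 0 ↔ W j = 1 := by omega
      simp only [this]
      split_ifs <;> rfl
    rw [gate] at g1 g2
    fin_cases a
    · simp [Fin.sum_univ_succ]
    · simp [Fin.sum_univ_succ]
      rw [e1, ← g1]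
      push_cast
      generalize hx : relu (A k) = x at hr ⊢
      generalize hy : relu (-A k) = y at hr ⊢
      -- `σ(a) - σ(-a) = a`: the old content of the block cancels and only the gated value remains.
      obtain rfl : y = x - A k := by linarith
      ring_nf
    · simp [Fin.sum_univ_succ]
    · simp [Fin.sum_univ_succ]
      rw [e2, ← g2]
      push_cast
      ring_nf
  · rw [Layer.apply]
    unfold neighbourSpec at hG ⊢
    rw [scl_ffn_mk _ _ _ _ _ _ _ hG]
    simp

/-- Only the last token's source matters, because later layers never read the input block of a key.
The values at other tokens are therefore left existential. -/
theorem inputSpec_apply (hS : 1 ≤ S) (hq : (q : ℕ) + 1 = n) {N : ℕ} (hN : 1 ≤ N) (hNn : N ≤ n)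
    (U : ℕ → Fin d → ℝ) (W : ℕ → ℤ) (A C : ℕ → Fin d → ℝ) (t : ℕ → ℝ)
    {H : TokenSeq (4 * d + 8) n}
    (hH : ∀ j : Fin n, H j = mkVec ![U j, A j, 0, C j]
      ![S * N, t j, 0, 0, 1, S, S * W j, S * ((j : ℕ) + 1)]) :
    ∃ (B : ℕ → Fin d → ℝ) (σ : ℕ → ℝ),
      B q = reluVec (U (n - N)) ∧ σ q = S * W (n - N) ∧
      ∀ j : Fin n, (inputSpec.toLayer d).apply H j = mkVec ![U j, A j, B j, C j]
        ![S * N, t j, σ j, 0, 1, S, S * W j, S * ((j : ℕ) + 1)] := by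
  have h1 : ∀ j', sourceSel.weight (H q) (H j') = if (j' : ℕ) = n - N then 1 else 0 := by
    intro j'
    have := gate_mul_intCast (S := S) (a := 1) (by linarith) (by simpa using hS)
      ((j' : ℤ) - q - 1 + N)
    have e : (j' : ℤ) - q - 1 + N = 0 ↔ (j' : ℕ) = n - N := by omega
    simp only [e] at this
    rw [← this]
    simp only [Selector.weight, sourceSel, hH, scl_mkVec, form_add,
      form_single, blkForm_zero, Matrix.cons_val]
    push_cast
    ring_nf
  have hb := sum_fin_ite_eq (n := n) (n - N) fun i => U i
  have ht := sum_fin_ite_eq (n := n) (n - N) fun i => S * (W i : ℝ)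
  rw [if_pos (by omega)] at hb ht
  set B : Fin n → Fin d → ℝ := fun j => ∑ j', sourceSel.weight (H j) (H j') • U j' with hB
  set σ : Fin n → ℝ := fun j => ∑ j', sourceSel.weight (H j) (H j') * (S * W j') with hσ
  have hBq : B q = U (n - N) := by
    rw [← hb]; simp only [hB, h1, ite_smul, one_smul, zero_smul]
  have hσq : σ q = S * W (n - N) := by
    rw [← ht]; simp only [hσ, h1, ite_mul, one_mul, zero_mul]
  have hG : ∀ j : Fin n, (inputSpec.toLayer d).attn H j = mkVec ![U j, A j, B j, C j]
        ![S * N, t j, σ j, 0, 1, S, S * W j, S * ((j : ℕ) + 1)] := by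
    intro j
    refine eq_mkVec (fun a => ?_) fun t => ?_
    · rw [blk_attn_toLayer]
      simp only [inputSpec, Matrix.cons_val_zero, Matrix.cons_val_one, zeroSel_weight]
      simp only [sourceSel, sum_single_smul]
      fin_cases a <;> simp [hH, hB, sourceSel]
    · rw [scl_attn_toLayer]
      simp only [inputSpec, Matrix.cons_val_zero, Matrix.cons_val_one, zeroSel_weight]
      simp only [sourceSel, single_mulVec_apply]
      fin_cases t <;> simp [hH, hσ, sourceSel]
  refine ⟨fun j => if h : j < n then reluVec (B ⟨j, h⟩) else 0,
    fun j => if h : j < n then σ ⟨j, h⟩ else 0, ?_, ?_, fun j => ?_⟩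
  · simp [hBq]
  · simp [hσq]
  · refine eq_mkVec (fun a => funext fun k => ?_) fun t => ?_
    · rw [Layer.apply]
      have hG := hG j
      unfold inputSpec at hG ⊢
      rw [blk_ffn_mk _ _ _ _ _ _ _ hG]
      -- Adding `σ(-b)` to `b` yields `σ(b)`, so one hidden unit per coordinate suffices.
      have hr := relu_sub_relu_neg (B j k)
      fin_cases a
      · simp
      · simp
      · simp [Fin.sum_univ_succ, reluVec]
        linarith
      · simp
    · rw [Layer.apply]
      have hG := hG j
      unfold inputSpec at hG ⊢
      rw [scl_ffn_mk _ _ _ _ _ _ _ hG]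
      simp

/-- A rank-one matrix `u vᵀ` acts on `x` as `(x ⬝ᵥ v) • u`: the inner product is the gate weight and
`u` the value. The bounds by `S` are what the gates require. -/
theorem weightSpec_apply (hS : 0 ≤ S) {N : ℕ}
    (U : ℕ → Fin d → ℝ) (W : ℕ → ℤ) (A B C : ℕ → Fin d → ℝ) (t σ : ℕ → ℝ) (w : ℤ)
    (hσ : σ q = S * w) (hA : ∀ j < n, |B q ⬝ᵥ A j| ≤ S) (hC : ∀ j < n, |B q ⬝ᵥ C j| ≤ S)
    {H : TokenSeq (4 * d + 8) n}
    (hH : ∀ j : Fin n, H j = mkVec ![U j, A j, B j, C j]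
      ![S * N, t j, σ j, 0, 1, S, S * W j, S * ((j : ℕ) + 1)]) :
    ∃ (A' : ℕ → Fin d → ℝ) (g : ℕ → ℝ),
      A' q = A q + ∑ j : Fin n, (if W j = 1 - 2 * w then B q ⬝ᵥ A j else 0) • U j ∧
      g q = ∑ j : Fin n, B q ⬝ᵥ C j ∧
      ∀ j : Fin n, (weightSpec.toLayer d).apply H j = mkVec ![U j, A' j, B j, C j]
        ![S * N, t j, σ j, g j, 1, S, S * W j, S * ((j : ℕ) + 1)] := by
  have h1 : ∀ j', pairSel.weight (H q) (H j') =
      if W j' = 1 - 2 * w then B q ⬝ᵥ A j' else 0 := by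
    intro j'
    have := gate_mul_intCast hS (hA j' j'.2) (W j' - 1 + 2 * w)
    have e : W j' - 1 + 2 * w = 0 ↔ W j' = 1 - 2 * w := by omega
    simp only [e] at this
    rw [← this]
    simp only [Selector.weight, pairSel, hH, scl_mkVec, blk_mkVec, form_add, form_zero,
      form_single, blkForm_single, Matrix.cons_val, hσ]
    push_cast
    ring_nf
  have h2 : ∀ j', sumSel.weight (H q) (H j') = B q ⬝ᵥ C j' := by
    intro j'
    -- The condition of `sumSel` is identically zero, so its gate is always open; the restriction to
    -- tag `1` is already in `C`.
    have := gate_mul_intCast hS (hC j' j'.2) 0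
    simpa [Selector.weight, sumSel, hH] using this
  set A' : Fin n → Fin d → ℝ := fun j => A j + ∑ j', pairSel.weight (H j) (H j') • U j' with hA'
  set g : Fin n → ℝ := fun j => ∑ j', sumSel.weight (H j) (H j') with hg
  refine ⟨fun j => if h : j < n then A' ⟨j, h⟩ else 0,
    fun j => if h : j < n then g ⟨j, h⟩ else 0, ?_, ?_, fun j => ?_⟩
  · simp [hA', h1]
  · simp [hg, h2]
  · rw [Layer.apply, ffn_eq_self _ rfl rfl]
    refine eq_mkVec (fun a => ?_) fun t => ?_
    · rw [blk_attn_toLayer]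
      simp only [weightSpec, Matrix.cons_val_zero, Matrix.cons_val_one]
      simp only [pairSel, sumSel, sum_single_smul]
      fin_cases a <;> simp [hH, hA', pairSel]
    · rw [scl_attn_toLayer]
      simp only [weightSpec, Matrix.cons_val_zero, Matrix.cons_val_one]
      simp only [pairSel, sumSel, single_mulVec_apply]
      fin_cases t <;> simp [hH, hg, sumSel]

/-- With zero-based indices the last token is `n - 1`, so `N` places back is `n - N - 1`. The sign
hypotheses let single ReLUs erase the input block and handle the tags. -/
theorem outputSpec_apply (hS : 0 ≤ S) (hq : (q : ℕ) + 1 = n) {N : ℕ} (hNn : N < n)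
    (U : ℕ → Fin d → ℝ) (W : ℕ → ℤ) (A B C : ℕ → Fin d → ℝ) (t σ g : ℕ → ℝ) (w : ℤ)
    (hσ : σ q = S * w) (hw : w ≤ 0) (hWq : W q ≤ 0) (hBq : ∀ k, 0 ≤ B q k) (hCq : C q = 0)
    (htq : t q = 0) (hg : |g q| ≤ S)
    {H : TokenSeq (4 * d + 8) n}
    (hH : ∀ j : Fin n, H j = mkVec ![U j, A j, B j, C j]
      ![S * N, t j, σ j, g j, 1, S, S * W j, S * ((j : ℕ) + 1)]) :
    (outputSpec.toLayer d).apply H q =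
      token (A q + g q • C (n - N - 1)) (posEnc d (w - 1) (n + 1) S) := by
  have h1 : ∀ j', backSel.weight (H q) (H j') = if (j' : ℕ) = n - N - 1 then g q else 0 := by
    intro j'
    have := gate_mul_intCast hS hg ((j' : ℤ) - q + N)
    have e : (j' : ℤ) - q + N = 0 ↔ (j' : ℕ) = n - N - 1 := by omega
    simp only [e] at this
    rw [← this]
    simp only [Selector.weight, backSel, hH, scl_mkVec, form_add,
      form_single, blkForm_zero, Matrix.cons_val]
    push_cast
    ring_nf
  have hb := sum_fin_ite_eq (n := n) (n - N - 1) fun i => g q • C i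
  rw [if_pos (by omega)] at hb
  have hG : (outputSpec.toLayer d).attn H q = mkVec ![U q, A q + g q • C (n - N - 1), B q, 0]
        ![S * N, 0, S * w, g q, 1, S, S * W q, S * ((q : ℕ) + 1)] := by
    refine eq_mkVec (fun a => ?_) fun t => ?_
    · rw [blk_attn_toLayer]
      simp only [outputSpec, Matrix.cons_val_zero, Matrix.cons_val_one, zeroSel_weight, h1]
      simp only [backSel, sum_single_smul, ← hb]
      fin_cases a <;> simp [hH, hCq]
    · rw [scl_attn_toLayer]
      simp only [outputSpec, Matrix.cons_val_zero, Matrix.cons_val_one, zeroSel_weight]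
      simp only [backSel]
      fin_cases t <;> simp [hH, htq, hσ]
  have hn : ((q : ℕ) : ℝ) + 1 = n := by exact_mod_cast hq
  rw [token_posEnc]
  refine eq_mkVec (fun a => funext fun k => ?_) fun t => ?_
  · rw [Layer.apply]
    unfold outputSpec at hG ⊢
    rw [blk_ffn_mk _ _ _ _ _ _ _ hG]
    have hr1 := relu_sub_relu_neg (U q k)
    have hr2 := relu_sub_relu_neg ((A q + g q • C (n - N - 1)) k)
    have hr3 := relu_of_nonneg (hBq k)
    generalize A q + g q • C (n - N - 1) = y at hr2
    fin_cases a <;> simp [Fin.sum_univ_succ, hr3] <;> linarith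
  · rw [Layer.apply]
    unfold outputSpec at hG ⊢
    rw [scl_ffn_mk _ _ _ _ _ _ _ hG]
    have hr1 := relu_sub_relu_neg (g q)
    have hr2 : relu (S * N) = S * N := relu_of_nonneg (by positivity)
    have hr3 : relu (-(S * w)) = -(S * w) := relu_of_nonneg (by
      have : (w : ℝ) ≤ 0 := by exact_mod_cast hw
      nlinarith)
    have hr4 : relu (-(S * W q)) = -(S * W q) := relu_of_nonneg (by
      have : (W q : ℝ) ≤ 0 := by exact_mod_cast hWq
      nlinarith)
    have hr5 := relu_of_nonneg hS
    fin_cases t <;> simp [Fin.sum_univ_succ, hr2, hr3, hr4, hr5, hn] <;>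
      linarith

end

end

/-! ### Composition of the layers -/

section

variable {d n : ℕ}

/-- The layers of the transformer which executes prompts. -/
def promptSpec : Fin 7 → LayerSpec :=
  ![neighbourSpec, inputSpec, weightSpec, outputSpec, idSpec, idSpec, idSpec]

/-- The transformer which executes prompts. -/
def promptTransformer (d : ℕ) : Transformer (4 * d + 8) 7 := fun k => (promptSpec k).toLayer d

theorem promptTransformer_apply_last {S : ℝ} (hS : 1 ≤ S) {q : Fin n} (hq : (q : ℕ) + 1 = n)
    {N : ℕ} (hN : 1 ≤ N) (hNn : N < n) (U : ℕ → Fin d → ℝ) (W : ℕ → ℤ)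
    (hcount : (∑ j : Fin n, if W j = 0 then 1 else 0) = N) (hU : ∀ j < n, ∀ k, |U j k| ≤ S)
    (hWq : W q ≤ 0) (hw : W (n - N) ≤ 0) (A C : ℕ → Fin d → ℝ)
    (hA : ∀ j, A j = if j + 1 < n ∧ W (j + 1) = W j + 1 then U (j + 1) else 0)
    (hC : ∀ j, C j = if W j = 1 then U j else 0)
    (hxA : ∀ j < n, |reluVec (U (n - N)) ⬝ᵥ A j| ≤ S)
    (hxC : ∀ j < n, |reluVec (U (n - N)) ⬝ᵥ C j| ≤ S)
    (hxg : |∑ j : Fin n, reluVec (U (n - N)) ⬝ᵥ C j| ≤ S)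
    {H : TokenSeq (4 * d + 8) n}
    (hH : ∀ j, H j = token (U j) (posEnc d (W j) (j + 1) S)) :
    (promptTransformer d).apply H q =
      token (∑ j : Fin n, (if W j = 1 - 2 * W (n - N) then reluVec (U (n - N)) ⬝ᵥ A j else 0) • U j +
          (∑ j : Fin n, reluVec (U (n - N)) ⬝ᵥ C j) • C (n - N - 1))
        (posEnc d (W (n - N) - 1) (n + 1) S) := by
  have hS0 : 0 ≤ S := by linarith
  have happ : (promptTransformer d).apply H = (outputSpec.toLayer d).apply
      ((weightSpec.toLayer d).apply ((inputSpec.toLayer d).apply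
        ((neighbourSpec.toLayer d).apply H))) := by
    simp [Transformer.apply, promptTransformer, promptSpec, List.ofFn_succ, idSpec_apply]
  rw [happ]
  set t : ℕ → ℝ := fun j => S * (if j + 1 < n then W (j + 1) else 0 : ℤ) with ht
  obtain ⟨B, σ, hB, hσ, h2⟩ := inputSpec_apply (q := q) hS hq hN hNn.le U W A C t
    (H := (neighbourSpec.toLayer d).apply H) (fun j => by
      rw [neighbourSpec_apply hS U W hU hH j, hA, hC, hcount])
  rw [← hB] at hxA hxC hxg
  obtain ⟨A', g, hA', hg, h3⟩ := weightSpec_apply hS0 U W A B C t σ (W (n - N)) hσ hxA hxC h2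
  rw [outputSpec_apply hS0 hq hNn U W A' B C t σ g (W (n - N)) hσ hw hWq
    (fun k => by rw [hB]; exact le_max_left _ _) (by rw [hC, if_neg (by omega)])
    -- The last token has no successor, so its next tag and next embedding are `0`; the block in
    -- which the sum is accumulated starts empty.
    (by simp [ht, hq]) (by rw [hg]; exact hxg) h3, hA', hg, hB, hA, if_neg (by omega), zero_add]

/-! ### Bounds for the virtual network -/

/-- The Euclidean norm. -/
def eNorm (x : Fin d → ℝ) : ℝ := ‖WithLp.toLp 2 x‖

theorem eNorm_nonneg (x : Fin d → ℝ) : 0 ≤ eNorm x := norm_nonneg _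

theorem eNorm_zero : eNorm (0 : Fin d → ℝ) = 0 := norm_zero (E := EuclideanSpace ℝ (Fin d))

theorem eNorm_add_le (x y : Fin d → ℝ) : eNorm (x + y) ≤ eNorm x + eNorm y :=
  norm_add_le (E := EuclideanSpace ℝ (Fin d)) _ _

theorem eNorm_smul (c : ℝ) (x : Fin d → ℝ) : eNorm (c • x) = |c| * eNorm x := by
  rw [eNorm, WithLp.toLp_smul, norm_smul, Real.norm_eq_abs, eNorm]

theorem eNorm_sum_le {ι : Type*} (s : Finset ι) (f : ι → Fin d → ℝ) :
    eNorm (∑ i ∈ s, f i) ≤ ∑ i ∈ s, eNorm (f i) :=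
  Finset.le_sum_of_subadditive eNorm eNorm_zero.le eNorm_add_le s f

theorem eNorm_eq_sqrt (x : Fin d → ℝ) : eNorm x = √(∑ k, x k ^ 2) := by
  simp [eNorm, EuclideanSpace.norm_eq]

theorem abs_apply_le_eNorm (x : Fin d → ℝ) (k : Fin d) : |x k| ≤ eNorm x :=
  PiLp.norm_apply_le (WithLp.toLp 2 x) k

theorem abs_dotProduct_le (x y : Fin d → ℝ) : |x ⬝ᵥ y| ≤ eNorm x * eNorm y := by
  have := abs_real_inner_le_norm (WithLp.toLp 2 y : EuclideanSpace ℝ (Fin d)) (WithLp.toLp 2 x)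
  rw [mul_comm]
  simpa [eNorm, EuclideanSpace.inner_eq_star_dotProduct] using this

theorem eNorm_le_eNorm {x y : Fin d → ℝ} (h : ∀ k, |x k| ≤ |y k|) : eNorm x ≤ eNorm y := by
  rw [eNorm_eq_sqrt, eNorm_eq_sqrt]
  exact Real.sqrt_le_sqrt (Finset.sum_le_sum fun k _ => sq_le_sq.2 (h k))

theorem eNorm_reluVec_le (x : Fin d → ℝ) : eNorm (reluVec x) ≤ eNorm x :=
  eNorm_le_eNorm fun k => by
    change |max 0 (x k)| ≤ |x k|
    rw [abs_of_nonneg (le_max_left _ _)]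
    exact max_le (abs_nonneg _) (le_abs_self _)

theorem eNorm_le_sqrt {z : Fin d → ℝ} (hz : ∀ k, z k ∈ Set.Icc (0 : ℝ) 1) : eNorm z ≤ √d := by
  rw [eNorm_eq_sqrt]
  refine Real.sqrt_le_sqrt ?_
  calc ∑ k, z k ^ 2 ≤ ∑ _k : Fin d, (1 : ℝ) :=
        Finset.sum_le_sum fun k _ => pow_le_one₀ (hz k).1 (hz k).2
    _ = d := by simp

theorem vecMulVec_mulVec_eq (u v x : Fin d → ℝ) : Matrix.vecMulVec u v *ᵥ x = (x ⬝ᵥ v) • u := by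
  rw [Matrix.vecMulVec_mulVec, dotProduct_comm]
  simp

section

variable {T : ℕ} {B : ℝ} {H : TokenSeq (4 * d + 8) T} {w : Fin T → ℤ}

theorem promptWeight_mulVec (ℓ : ℕ) (x : Fin d → ℝ) :
    promptWeight H w ℓ *ᵥ x = ∑ j : Fin (T - 1),
      (if w ⟨j, by omega⟩ = 2 * (ℓ : ℤ) - 1 ∧ w ⟨j + 1, by omega⟩ = 2 * (ℓ : ℤ) then
        x ⬝ᵥ emb (H ⟨j + 1, by omega⟩) else 0) • emb (H ⟨j, by omega⟩) := by
  rw [promptWeight, Matrix.sum_mulVec]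
  refine Finset.sum_congr rfl fun j _ => ?_
  split_ifs
  · exact vecMulVec_mulVec_eq _ _ _
  · simp

theorem firstWeight_mulVec (hT : 0 < T) (i : ℕ) (x : Fin d → ℝ) :
    firstWeight hT H w i *ᵥ x = promptWeight H w 1 *ᵥ x +
      if i = 0 ∧ w ⟨T - 1, by omega⟩ = 1 then
        (∑ j, x ⬝ᵥ (if w j = 1 then emb (H j) else 0)) • emb (H ⟨T - 1, by omega⟩)
      else 0 := by
  rw [firstWeight, Matrix.add_mulVec]
  congr 1
  split_ifs
  · rw [vecMulVec_mulVec_eq, dotProduct_sum]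
  · simp

theorem abs_dotProduct_le_of_le {x y : Fin d → ℝ} (hy : eNorm y ≤ B) :
    |x ⬝ᵥ y| ≤ eNorm x * B :=
  (abs_dotProduct_le x y).trans (mul_le_mul_of_nonneg_left hy (eNorm_nonneg x))

theorem eNorm_promptWeight_mulVec_le (hB : 0 ≤ B) (hH : ∀ j, eNorm (emb (H j)) ≤ B) (ℓ : ℕ)
    (x : Fin d → ℝ) : eNorm (promptWeight H w ℓ *ᵥ x) ≤ ((T - 1 : ℕ) : ℝ) * (eNorm x * B * B) := by
  have hx := eNorm_nonneg x
  rw [promptWeight_mulVec]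
  refine (eNorm_sum_le _ _).trans ?_
  calc _ ≤ ∑ _j : Fin (T - 1), eNorm x * B * B := Finset.sum_le_sum fun j _ => by
        rw [eNorm_smul]
        refine mul_le_mul ?_ (hH _) (eNorm_nonneg _) (by positivity)
        split_ifs
        · exact abs_dotProduct_le_of_le (hH _)
        · simpa using mul_nonneg hx hB
    _ = _ := by simp

theorem abs_sum_dotProduct_le {x : Fin d → ℝ} {c : Fin T → Fin d → ℝ} (hc : ∀ j, eNorm (c j) ≤ B) :
    |∑ j, x ⬝ᵥ c j| ≤ T * (eNorm x * B) := by
  refine (Finset.abs_sum_le_sum_abs _ _).trans ?_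
  calc _ ≤ ∑ _j : Fin T, eNorm x * B :=
        Finset.sum_le_sum fun j _ => abs_dotProduct_le_of_le (hc j)
    _ = _ := by simp

theorem eNorm_firstWeight_mulVec_le (hT : 0 < T) (hB : 0 ≤ B) (hH : ∀ j, eNorm (emb (H j)) ≤ B)
    (i : ℕ) (x : Fin d → ℝ) :
    eNorm (firstWeight hT H w i *ᵥ x) ≤ T ^ 2 * (eNorm x * B * B) := by
  have hx := eNorm_nonneg x
  have h1 := eNorm_promptWeight_mulVec_le (w := w) hB hH 1 x
  rw [firstWeight_mulVec]
  refine (eNorm_add_le _ _).trans ?_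
  have h2 : eNorm (if i = 0 ∧ w ⟨T - 1, by omega⟩ = 1 then
        (∑ j, x ⬝ᵥ (if w j = 1 then emb (H j) else 0)) • emb (H ⟨T - 1, by omega⟩)
      else 0) ≤ T * (eNorm x * B * B) := by
    split_ifs
    · rw [eNorm_smul, ← mul_assoc]
      refine mul_le_mul ?_ (hH _) (eNorm_nonneg _) (by positivity)
      refine abs_sum_dotProduct_le fun j => ?_
      split_ifs
      · exact hH j
      · rwa [eNorm_zero]
    · rw [eNorm_zero]; positivity
  -- At most `T - 1` pairs and `T` boundary terms; the inequality is `(T - 1)² ≥ 0`.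
  have h3 : ((T - 1 : ℕ) : ℝ) + T ≤ T ^ 2 := by
    rw [Nat.cast_sub hT]
    push_cast
    nlinarith [sq_nonneg ((T : ℝ) - 1)]
  have h4 : 0 ≤ eNorm x * B * B := by positivity
  nlinarith

/-- The first matrix costs `T² B²`, each later one `T B²`, and ReLU does not increase the norm. -/
theorem eNorm_network_le (hT : 0 < T) (hB : 0 ≤ B) (hH : ∀ j, eNorm (emb (H j)) ≤ B) (i : ℕ)
    {z : Fin d → ℝ} (hz : ∀ k, z k ∈ Set.Icc (0 : ℝ) 1) (ℓ : ℕ) :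
    eNorm (network (firstWeight hT H w i) (promptWeight H w) z ℓ) ≤
      T ^ (ℓ + 1) * B ^ (2 * ℓ) * √d := by
  have hT1 : (1 : ℝ) ≤ T := by exact_mod_cast hT
  have hz' := eNorm_le_sqrt hz
  induction ℓ using Nat.strong_induction_on with
  | _ ℓ ih =>
    match ℓ with
    | 0 =>
      rw [network]
      have := mul_le_mul_of_nonneg_right hT1 (Real.sqrt_nonneg d)
      simp only [zero_add, pow_one, mul_zero, pow_zero, mul_one]
      linarith
    | 1 =>
      rw [network]
      refine (eNorm_firstWeight_mulVec_le hT hB hH i z).trans ?_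
      calc (T : ℝ) ^ 2 * (eNorm z * B * B) ≤ T ^ 2 * (√d * B * B) := by gcongr
        _ = _ := by ring
    | ℓ + 2 =>
      rw [network]
      have h1 := (eNorm_reluVec_le _).trans (ih (ℓ + 1) (by omega))
      refine (eNorm_promptWeight_mulVec_le hB hH _ _).trans ?_
      calc _ ≤ (T : ℝ) * (T ^ (ℓ + 1 + 1) * B ^ (2 * (ℓ + 1)) * √d * B * B) := by
            have := eNorm_nonneg (reluVec (network (firstWeight hT H w i) (promptWeight H w) z
              (ℓ + 1)))
            gcongr
            exact Nat.sub_le T 1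
        _ = _ := by ring

end

end

section

variable {d n : ℕ}

/-! ### The generated tokens -/

theorem sum_fin_eq_of_le {M : Type*} [AddCommMonoid M] {T n : ℕ} (hTn : T ≤ n) (F : ℕ → M)
    (hF : ∀ j, T ≤ j → j < n → F j = 0) : ∑ j : Fin n, F j = ∑ j : Fin T, F j := by
  rw [Fin.sum_univ_eq_sum_range F, Fin.sum_univ_eq_sum_range F]
  refine (Finset.sum_subset (Finset.range_mono hTn) fun j hj hj' => ?_).symm
  exact hF j (by simpa using hj') (by simpa using hj)

section

variable {T : ℕ}

/-- The embedding of token number `m + 1` in the sequence of prompt, data and generated tokens. -/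
def seqEmb (hT : 0 < T) (H : TokenSeq (4 * d + 8) T) (w : Fin T → ℤ) (N : ℕ)
    (z : ℕ → Fin d → ℝ) (m : ℕ) : Fin d → ℝ :=
  if h : m < T then emb (H ⟨m, h⟩)
  else network (firstWeight hT H w ((m - T) % N)) (promptWeight H w) (z ((m - T) % N)) ((m - T) / N)

/-- The tag of token number `m + 1` in the sequence of prompt, data and generated tokens. -/
def seqTag (w : Fin T → ℤ) (N m : ℕ) : ℤ :=
  if h : m < T then w ⟨m, h⟩ else -(((m - T) / N : ℕ) : ℤ)

variable {hT : 0 < T} {H : TokenSeq (4 * d + 8) T} {w : Fin T → ℤ} {N : ℕ}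
  {z : ℕ → Fin d → ℝ}

theorem seqEmb_of_lt (j : Fin T) : seqEmb hT H w N z j = emb (H j) := by
  simp [seqEmb]

theorem seqTag_of_lt (j : Fin T) : seqTag w N j = w j := by
  simp [seqTag]

theorem seqTag_of_le {m : ℕ} (h : T ≤ m) : seqTag w N m = -(((m - T) / N : ℕ) : ℤ) := by
  simp [seqTag, h]

theorem seqEmb_of_le {m : ℕ} (h : T ≤ m) : seqEmb hT H w N z m =
    network (firstWeight hT H w ((m - T) % N)) (promptWeight H w) (z ((m - T) % N))
      ((m - T) / N) := by
  simp [seqEmb, h]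

theorem seqTag_nonpos {m : ℕ} (h : T ≤ m) : seqTag w N m ≤ 0 := by
  rw [seqTag_of_le h]
  exact neg_nonpos.2 (Int.natCast_nonneg _)

/-- After the prompt the tags are nonpositive and never increase, and a prompt tag is at least `1`;
a rise by one can only occur between two prompt tokens. -/
theorem succ_lt_of_seqTag_succ (hw : ∀ j, 1 ≤ w j) {m : ℕ}
    (h : seqTag w N (m + 1) = seqTag w N m + 1) : m + 1 < T := by
  by_contra hm
  rcases Nat.lt_or_ge m T with hmT | hmT
  · have h1 := hw ⟨m, hmT⟩
    rw [← seqTag_of_lt (w := w) (N := N) ⟨m, hmT⟩] at h1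
    have h2 := seqTag_nonpos (w := w) (N := N) (not_lt.1 hm)
    simp only at h1
    omega
  · rw [seqTag_of_le hmT, seqTag_of_le (by omega)] at h
    have : (m - T) / N ≤ (m + 1 - T) / N := Nat.div_le_div_right (by omega)
    omega

/-- Prompt tags are positive and generated tags negative, so tag `0` marks exactly the data tokens,
at any stage of the generation. -/
theorem sum_seqTag_eq_zero (hw : ∀ j, 1 ≤ w j) (hN : 1 ≤ N) (v : ℕ) :
    (∑ j : Fin (T + N + v), if seqTag w N j = 0 then 1 else 0) = N := by
  have hiff : ∀ j, seqTag w N j = 0 ↔ j ∈ Finset.Ico T (T + N) := by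
    intro j
    rw [Finset.mem_Ico]
    rcases Nat.lt_or_ge j T with h | h
    · have h1 := hw ⟨j, h⟩
      rw [← seqTag_of_lt (w := w) (N := N) ⟨j, h⟩] at h1
      simp only at h1
      omega
    · rw [seqTag_of_le h, neg_eq_zero, Nat.cast_eq_zero, Nat.div_eq_zero_iff]
      omega
  simp only [hiff]
  rw [Fin.sum_univ_eq_sum_range (fun j => if j ∈ Finset.Ico T (T + N) then 1 else 0),
    Finset.sum_ite_mem, Finset.inter_eq_right.2]
  · simp
  · intro j hj
    simp only [Finset.mem_Ico, Finset.mem_range] at hj ⊢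
    omega

/-- The embedding of the next token, if its tag is the successor of the tag of the given one. -/
def nextEmb (U : ℕ → Fin d → ℝ) (W : ℕ → ℤ) (n j : ℕ) : Fin d → ℝ :=
  if j + 1 < n ∧ W (j + 1) = W j + 1 then U (j + 1) else 0

/-- The embedding of a token with tag `1`. -/
def tagOneEmb (U : ℕ → Fin d → ℝ) (W : ℕ → ℤ) (j : ℕ) : Fin d → ℝ :=
  if W j = 1 then U j else 0

theorem tagOneEmb_of_le {m : ℕ} (h : T ≤ m) :
    tagOneEmb (seqEmb hT H w N z) (seqTag w N) m = 0 := by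
  have := seqTag_nonpos (w := w) (N := N) h
  rw [tagOneEmb, if_neg (by omega)]

theorem tagOneEmb_of_lt (j : Fin T) :
    tagOneEmb (seqEmb hT H w N z) (seqTag w N) j = if w j = 1 then emb (H j) else 0 := by
  rw [tagOneEmb, seqTag_of_lt, seqEmb_of_lt]

theorem eNorm_nextEmb_le {B : ℝ} (hB : 0 ≤ B) (hH : ∀ j, eNorm (emb (H j)) ≤ B)
    (hw : ∀ j, 1 ≤ w j) (n j : ℕ) :
    eNorm (nextEmb (seqEmb hT H w N z) (seqTag w N) n j) ≤ B := by
  rw [nextEmb]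
  split_ifs with h
  · have := seqEmb_of_lt (hT := hT) (H := H) (w := w) (N := N) (z := z)
      ⟨j + 1, succ_lt_of_seqTag_succ hw h.2⟩
    simp only at this
    rw [this]
    exact hH _
  · rwa [eNorm_zero]

theorem eNorm_tagOneEmb_le {B : ℝ} (hB : 0 ≤ B) (hH : ∀ j, eNorm (emb (H j)) ≤ B) (j : ℕ) :
    eNorm (tagOneEmb (seqEmb hT H w N z) (seqTag w N) j) ≤ B := by
  rcases Nat.lt_or_ge j T with h | h
  · have := tagOneEmb_of_lt (hT := hT) (H := H) (w := w) (N := N) (z := z) ⟨j, h⟩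
    simp only at this
    rw [this]
    split_ifs
    · exact hH _
    · rwa [eNorm_zero]
  · rwa [tagOneEmb_of_le h, eNorm_zero]

/-- The mask only tests that the tag rises by one; combined with the key tag `2ℓ-1` this forces the
pair `2ℓ-1`, `2ℓ`. Terms from index `T - 1` on have a vanishing masked successor. -/
theorem sum_nextEmb_eq_promptWeight_mulVec (hw : ∀ j, 1 ≤ w j) (hTn : T ≤ n) (x : Fin d → ℝ)
    {ℓ : ℕ} :
    ∑ j : Fin n, (if seqTag w N j = 2 * (ℓ : ℤ) - 1 then
        x ⬝ᵥ nextEmb (seqEmb hT H w N z) (seqTag w N) n j else 0) • seqEmb hT H w N z j =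
      promptWeight H w ℓ *ᵥ x := by
  rw [sum_fin_eq_of_le (T := T - 1) (by omega) (fun j => (if seqTag w N j = 2 * (ℓ : ℤ) - 1 then
        x ⬝ᵥ nextEmb (seqEmb hT H w N z) (seqTag w N) n j else 0) • seqEmb hT H w N z j),
    promptWeight_mulVec]
  · refine Finset.sum_congr rfl fun j _ => ?_
    have e1 := seqTag_of_lt (w := w) (N := N) ⟨j, by omega⟩
    have e2 := seqTag_of_lt (w := w) (N := N) ⟨j + 1, by omega⟩
    have e3 := seqEmb_of_lt (hT := hT) (H := H) (w := w) (N := N) (z := z) ⟨j, by omega⟩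
    have e4 := seqEmb_of_lt (hT := hT) (H := H) (w := w) (N := N) (z := z) ⟨j + 1, by omega⟩
    simp only at e1 e2 e3 e4
    rw [nextEmb, e1, e2, e3, e4]
    congr 1
    have hj : (j : ℕ) + 1 < n := by omega
    by_cases h1 : w ⟨j, by omega⟩ = 2 * (ℓ : ℤ) - 1
    · simp only [h1, hj, true_and, if_true, sub_add_cancel]
      split_ifs <;> simp
    · simp [h1]
  · intro j hj _
    have h0 : nextEmb (seqEmb hT H w N z) (seqTag w N) n j = 0 := by
      rw [nextEmb, if_neg fun h => ?_]
      have := succ_lt_of_seqTag_succ hw h.2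
      omega
    simp [h0]

theorem token_pos_emb {S : ℝ} (h : Fin (4 * d + 8) → ℝ) {w : ℤ} {j : ℕ}
    (hp : pos h = posEnc d w j S) : h = token (emb h) (posEnc d w j S) := by
  rw [← hp]
  funext k
  simp only [token, emb, pos]
  split_ifs with hk
  · rfl
  · congr 1
    exact Fin.ext (by simp only; omega)

/-- The induction step of the generation: the layer formula at the source `T + v`, of depth `v / N`
and datum `v % N`, is matched with one more layer of the virtual network. -/
theorem promptTransformer_apply_seq {S B : ℝ} {L : ℕ} (hB : 1 ≤ B) (hd : 1 ≤ d)
    (hS : (d : ℝ) * B ^ (4 * L) * (T : ℝ) ^ (2 * L) ≤ S)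
    (hH : ∀ j, eNorm (emb (H j)) ≤ B) (hw : ∀ j, 1 ≤ w j) (hN : 1 ≤ N)
    (hz : ∀ i k, z i k ∈ Set.Icc (0 : ℝ) 1) {v : ℕ} (hv : v < N * L)
    {G : TokenSeq (4 * d + 8) (T + N + v)}
    (hG : ∀ j, G j = token (seqEmb hT H w N z j) (posEnc d (seqTag w N j) (j + 1) S))
    {q : Fin (T + N + v)} (hq : (q : ℕ) + 1 = T + N + v) :
    (promptTransformer d).apply G q = token (seqEmb hT H w N z (T + N + v))
      (posEnc d (seqTag w N (T + N + v)) (T + N + v + 1) S) := by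
  have hB0 : 0 ≤ B := by linarith
  have hT1 : (1 : ℝ) ≤ T := by exact_mod_cast hT
  have hd1 : (1 : ℝ) ≤ d := by exact_mod_cast hd
  have hsd : √(d : ℝ) ≤ d := Real.sqrt_le_self_iff.2 (Or.inr hd1)
  have hmL : v / N < L := Nat.div_lt_of_lt_mul hv
  have hL : 1 ≤ L := Nat.one_le_of_lt hmL
  -- Every gate bound below reduces to a monomial in `T` and `B` whose exponents are within these
  -- limits.
  have hS1 : ∀ {a b : ℕ}, a ≤ 2 * L → b ≤ 4 * L → (T : ℝ) ^ a * B ^ b * d ≤ S := by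
    intro a b ha hb
    refine le_trans ?_ hS
    calc (T : ℝ) ^ a * B ^ b * d ≤ T ^ (2 * L) * B ^ (4 * L) * d := by gcongr
      _ = _ := by ring
  have hSone : 1 ≤ S := by
    have := hS1 (a := 0) (b := 0) (by omega) (by omega)
    simp only [pow_zero, one_mul] at this
    linarith
  have hsub : T + N + v - N = T + v := by omega
  have hsrc : seqEmb hT H w N z (T + v) = network (firstWeight hT H w (v % N)) (promptWeight H w)
      (z (v % N)) (v / N) := by
    rw [seqEmb_of_le (by omega), Nat.add_sub_cancel_left]
  have htag : seqTag w N (T + v) = -((v / N : ℕ) : ℤ) := by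
    rw [seqTag_of_le (by omega), Nat.add_sub_cancel_left]
  generalize hm : v / N = m at hmL hsrc htag
  set x := reluVec (seqEmb hT H w N z (T + v)) with hx
  have hxn : eNorm x ≤ T ^ (m + 1) * B ^ (2 * m) * d := by
    refine (eNorm_reluVec_le _).trans ?_
    rw [hsrc]
    exact (eNorm_network_le hT hB0 hH _ (hz _) _).trans (by gcongr)
  have hxB : T * (eNorm x * B) ≤ S := by
    refine le_trans ?_ (hS1 (a := m + 2) (b := 2 * m + 1) (by omega) (by omega))
    calc T * (eNorm x * B) ≤ T * (T ^ (m + 1) * B ^ (2 * m) * d * B) := by gcongr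
      _ = _ := by ring
  have hxB' : eNorm x * B ≤ S := by
    have := mul_nonneg (eNorm_nonneg x) hB0
    nlinarith
  have hsumC : ∑ j : Fin (T + N + v), x ⬝ᵥ tagOneEmb (seqEmb hT H w N z) (seqTag w N) j =
      ∑ j : Fin T, x ⬝ᵥ (if w j = 1 then emb (H j) else 0) := by
    rw [sum_fin_eq_of_le (T := T) (by omega)
      (fun j => x ⬝ᵥ tagOneEmb (seqEmb hT H w N z) (seqTag w N) j)]
    · simp only [tagOneEmb_of_lt]
    · intro j hj _
      rw [tagOneEmb_of_le hj, dotProduct_zero]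
  have hU : ∀ j < T + N + v, ∀ k, |seqEmb hT H w N z j k| ≤ S := by
    intro j hj k
    refine (abs_apply_le_eNorm _ _).trans ?_
    rcases Nat.lt_or_ge j T with h | h
    · have e := seqEmb_of_lt (hT := hT) (H := H) (w := w) (N := N) (z := z) ⟨j, h⟩
      simp only at e
      rw [e]
      have := hS1 (a := 0) (b := 1) (by omega) (by omega)
      simp only [pow_zero, pow_one, one_mul] at this
      nlinarith [hH ⟨j, h⟩]
    · rw [seqEmb_of_le h]
      have hjL : (j - T) / N ≤ L := by
        rw [← Nat.lt_succ_iff]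
        refine Nat.div_lt_of_lt_mul ?_
        rw [Nat.mul_succ]
        omega
      refine (eNorm_network_le hT hB0 hH _ (hz _) _).trans ?_
      generalize (j - T) / N = p at hjL ⊢
      refine le_trans ?_ (hS1 (a := p + 1) (b := 2 * p) (by omega) (by omega))
      gcongr
  have key := promptTransformer_apply_last hSone hq hN (by omega) (seqEmb hT H w N z) (seqTag w N)
    (sum_seqTag_eq_zero hw hN v) hU (seqTag_nonpos (by omega))
    (by rw [hsub]; exact seqTag_nonpos (by omega))
    (nextEmb (seqEmb hT H w N z) (seqTag w N) (T + N + v))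
    (tagOneEmb (seqEmb hT H w N z) (seqTag w N)) (fun _ => rfl) (fun _ => rfl)
    (fun j _ => by
      rw [hsub]
      exact (abs_dotProduct_le_of_le (eNorm_nextEmb_le hB0 hH hw _ _)).trans hxB')
    (fun j _ => by
      rw [hsub]
      exact (abs_dotProduct_le_of_le (eNorm_tagOneEmb_le hB0 hH _)).trans hxB')
    (by
      rw [hsub, ← hx, hsumC]
      refine (abs_sum_dotProduct_le fun j => ?_).trans hxB
      rw [← tagOneEmb_of_lt (hT := hT) (N := N) (z := z)]
      exact eNorm_tagOneEmb_le hB0 hH _) hG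
  have hdiv : (T + N + v - T) / N = m + 1 := by
    rw [show T + N + v - T = v + N by omega, Nat.add_div_right _ hN, hm]
  have hmod : (T + N + v - T) % N = v % N := by
    rw [show T + N + v - T = v + N by omega, Nat.add_mod_right]
  have hcoef : 1 - 2 * seqTag w N (T + v) = 2 * ((m + 1 : ℕ) : ℤ) - 1 := by
    rw [htag]; push_cast; ring
  rw [key, hsub, ← hx, hsumC, hcoef, sum_nextEmb_eq_promptWeight_mulVec hw (by omega),
    seqEmb_of_le (m := T + N + v) (by omega), seqTag_of_le (m := T + N + v) (by omega), hdiv, hmod,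
    htag]
  have hp : (-(m : ℤ)) - 1 = -((m + 1 : ℕ) : ℤ) := by push_cast; ring
  rw [hp]
  congr 1
  -- At depth `0` the source is a datum in `[0,1]^d`, on which the ReLU of the second layer has no
  -- effect.
  rcases Nat.eq_zero_or_pos m with h0 | h0
  · have hvN : v < N := by
      rw [← hm, Nat.div_eq_zero_iff] at h0
      omega
    have hxz : x = z (v % N) := by
      rw [hx, hsrc, h0, network]
      funext k
      exact max_eq_right (hz _ k).1
    rw [h0, network, firstWeight_mulVec, hxz]
    congr 1
    rw [Nat.mod_eq_of_lt hvN]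
    -- Only for `v = 0` is the token `N` places back, at index `T + v - 1`, still in the prompt:
    -- hence the extra term for the first datum alone.
    rcases Nat.eq_zero_or_pos v with hv0 | hv0
    · subst hv0
      have e := tagOneEmb_of_lt (hT := hT) (H := H) (w := w) (N := N) (z := z) ⟨T - 1, by omega⟩
      simp only at e
      rw [Nat.add_zero, e]
      simp only [true_and]
      split_ifs <;> simp
    · rw [tagOneEmb_of_le (by omega), if_neg (by omega), smul_zero]
  · have hv0 : 0 < v := by
      by_contra hv0
      obtain rfl : v = 0 := by omega
      simp [← hm] at h0
    obtain ⟨m', hm'⟩ : ∃ m', m = m' + 1 := ⟨m - 1, by omega⟩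
    rw [tagOneEmb_of_le (by omega), smul_zero, add_zero, hm', network, hx, hsrc, hm']

theorem generate_eq_seq {S B : ℝ} {L : ℕ} (hB : 1 ≤ B) (hd : 1 ≤ d)
    (hS : (d : ℝ) * B ^ (4 * L) * (T : ℝ) ^ (2 * L) ≤ S)
    (hH : ∀ j, eNorm (emb (H j)) ≤ B) (hw : ∀ j, 1 ≤ w j) (hN : 1 ≤ N)
    (hz : ∀ i k, z i k ∈ Set.Icc (0 : ℝ) 1) {H₀ : TokenSeq (4 * d + 8) (T + N)}
    (hH₀ : ∀ j, H₀ j = token (seqEmb hT H w N z j) (posEnc d (seqTag w N j) (j + 1) S))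
    (v : ℕ) (hv : v ≤ N * L) (j : Fin (T + N + v)) :
    generate (promptTransformer d) (Nat.add_pos_left hT N) H₀ v j =
      token (seqEmb hT H w N z j) (posEnc d (seqTag w N j) (j + 1) S) := by
  induction v with
  | zero => exact hH₀ j
  | succ v ih =>
    rw [generate]
    refine Fin.lastCases ?_ (fun j => ?_) j
    · rw [Fin.snoc_last, lastToken]
      exact promptTransformer_apply_seq hB hd hS hH hw hN hz (by omega) (ih (by omega))
        (by simp only; omega)
    · rw [Fin.snoc_castSucc]
      exact ih (by omega) j

end

end

end PromptTF

end

/-! ### The theorem -/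

theorem mainTheorem2 :
    ∃ C₁ C₂ C₃ : ℝ, ∀ d : ℕ, 1 ≤ d → ∃ Θ : Transformer (4 * d + 8) 7,
      -- number of heads and width of the feed-forward networks
      (∀ k, (Θ k).heads ≤ 8 ∧ ((Θ k).width : ℝ) ≤ C₁ * d) ∧
      -- number and size of the nonzero parameters
      ((Transformer.zeroNorm Θ : ℝ) ≤ C₂ * d ∧ (Transformer.maxNorm Θ : ℝ) ≤ C₃) ∧
      -- the generated tokens
      ∀ (B : ℝ), 1 ≤ B → ∀ (L T : ℕ), 1 ≤ L → ∀ (hT : 0 < T),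
      ∀ U : Set (EuclideanSpace ℝ (Fin d)), U ⊆ Metric.closedBall 0 B →
      ∀ S : ℝ, max ((d : ℝ) * B ^ (4 * L) * (T : ℝ) ^ (2 * L)) (2 * (L : ℝ)) ≤ S →
      ∀ H ∈ promptClass U T L S, ∀ w : Fin T → ℤ, HasTags S H w →
      ∀ N : ℕ, 1 ≤ N → ∀ z : Fin N → Fin d → ℝ, (∀ i k, z i k ∈ Set.Icc (0 : ℝ) 1) →
      ∀ (i : Fin N) (ℓ : ℕ), 1 ≤ ℓ → ℓ ≤ L →
        -- step `v` generates the token number `T + N + v + 1`, here `T + N * ℓ + (i + 1)`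
        ∀ v : ℕ, T + N + v + 1 = T + N * ℓ + ((i : ℕ) + 1) →
          generatedToken Θ (Nat.add_pos_left hT N) (Fin.append H (dataTokens z T S)) v =
            token (network (firstWeight hT H w i) (promptWeight H w) (z i) ℓ)
              (posEnc d (-(ℓ : ℤ)) (T + N * ℓ + ((i : ℕ) + 1)) S) := by
  obtain ⟨C₁, h₁⟩ := exists_width_le promptSpec
  obtain ⟨C₂, h₂⟩ := exists_zeroNorm_le promptSpec
  obtain ⟨C₃, h₃⟩ := exists_maxNorm_le promptSpec
  refine ⟨C₁, C₂, C₃, fun d hd => ⟨promptTransformer d,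
    fun k => ⟨le_rfl, by exact_mod_cast h₁ d hd k⟩,
    ⟨by exact_mod_cast h₂ d hd, by exact_mod_cast h₃ d⟩, ?_⟩⟩
  intro B hB L T hL hT U hU S hS H hHP w hw N hN z hz i ℓ hℓ hℓL v hv
  have hS0 : S ≠ 0 := by
    have h1 := (le_max_right _ _).trans hS
    have h2 : (1 : ℝ) ≤ L := by exact_mod_cast hL
    linarith
  obtain ⟨u, w', hu, hw', hHu⟩ := hHP
  obtain rfl : w = w' := hw.unique hS0 fun j => by rw [hHu j, pos_token]
  have hembu : ∀ j, emb (H j) = u j := by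
    intro j
    funext k
    simp [hHu j, emb, token]
  have hH : ∀ j, eNorm (emb (H j)) ≤ B := by
    intro j
    rw [hembu]
    simpa [eNorm] using hU (hu j)
  -- Extension by `0` stays in `[0,1]^d`, so the bounds on the data hold for all indices.
  set z' : ℕ → Fin d → ℝ := fun i => if h : i < N then z ⟨i, h⟩ else 0 with hz'
  have hzi : ∀ i : Fin N, z' i = z i := fun i => by simp [hz']
  have hz01 : ∀ i k, z' i k ∈ Set.Icc (0 : ℝ) 1 := by
    intro i k
    simp only [hz']
    split_ifs
    · exact hz _ k
    · simp
  -- Data tokens have quotient `0`, and the network of depth `0` returns the datum itself.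
  have hH₀ : ∀ j : Fin (T + N), (Fin.append H (dataTokens z T S) : TokenSeq (4 * d + 8) _) j =
      token (seqEmb hT H w N z' j) (posEnc d (seqTag w N j) (j + 1) S) := by
    refine Fin.addCases (fun j => ?_) fun j => ?_
    · rw [Fin.append_left, Fin.val_castAdd, seqEmb_of_lt, seqTag_of_lt]
      exact token_pos_emb _ (hw j)
    · rw [Fin.append_right, Fin.val_natAdd, seqEmb_of_le (by omega), seqTag_of_le (by omega),
        Nat.add_sub_cancel_left, Nat.div_eq_of_lt j.2, Nat.mod_eq_of_lt j.2, network, hzi]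
      simp [dataTokens, dataToken, add_assoc]
  have hvN : v + N = N * ℓ + i := by omega
  have hvL : v < N * L := by
    have : N * ℓ ≤ N * L := Nat.mul_le_mul_left _ hℓL
    omega
  have hstep := promptTransformer_apply_seq hB hd ((le_max_left _ _).trans hS) hH (fun j => (hw' j).1)
    hN hz01 hvL (generate_eq_seq hB hd ((le_max_left _ _).trans hS) hH (fun j => (hw' j).1) hN hz01
      hH₀ v hvL.le) (q := ⟨T + N + v - 1, by omega⟩) (by simp only; omega)
  rw [generatedToken, lastToken, hstep, seqEmb_of_le (by omega), seqTag_of_le (by omega),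
    show T + N + v - T = i + N * ℓ by omega, Nat.add_mul_div_left _ _ hN, Nat.div_eq_of_lt i.2,
    Nat.add_mul_mod_self_left, Nat.mod_eq_of_lt i.2, hzi, zero_add, hv]
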